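/- Let $H$ be a countable group, let $\vartheta : \Sigma \to \vartheta(\Sigma)$ be an isomorphism between subgroups of $H$ with $\Sigma \neq H \neq \vartheta(\Sigma)$, and let $$\Gamma = \mathrm{HNN}(H,\Sigma,\vartheta) = \langle H, t \mid t^{-1}\sigma t = \vartheta(\sigma) \text{ for all } \sigma \in \Sigma\rangle .$$ Let $\mathcal T$ be the Bass--Serre tree of $\Gamma$, and let its boundary $\partial\mathcal T$ be the set of geodesic rays modulo finite difference of their vertex sets, with the topology whose basic open sets are the sets of ends of half-trees. Assume that $\Gamma \curvearrowright \partial\mathcal T$ is topologically free, i.e. that only the trivial element of $\Gamma$ fixes a non-empty open subset of $\partial\mathcal T$ pointwise. Then $\Gamma$ has an action on a countably infinite set which is both highly transitive (every $k$-tuple of pairwise distinct points can be sent to every other one, for all $k \geq 1$) and highly faithful (the supports of any finitely many non-trivial elements have infinite intersection). In particular $\Gamma$ is highly transitive, i.e. it has a faithful highly transitive action on a countably infinite set. More precisely, let $X$ be a countably infinite set with a free right action $\pi : H \to S(X)$ having infinitely many orbits, where $S(X)$ is the group of permutations of $X$, acting on the right, with the topology of pointwise convergence. Let $\mathbf A =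 \{\tau \in S(X) : \pi(\sigma)\tau = \tau\pi(\vartheta(\sigma)) \text{ for all } \sigma \in \Sigma\}$, and for $\tau \in \mathbf A$ let $\pi_\tau$ be the action of $\Gamma$ on $X$ which extends $\pi$ and in which $t$ acts by $\tau$. Then the space $\mathbf{TA}$ of all $\tau\in\mathbf A$ with $\pi_\tau$ transitive is a non-empty Polish space, and the set of all $\tau \in \mathbf A$ for which $\pi_\tau$ is highly transitive and highly faithful is contained in $\mathbf{TA}$ and is a dense $G_\delta$ subset of it. -/

import Mathlib

/-! ### Right actions on sets -/

/-- The group `S(X)` of permutations of `X`, with the convention that permutations act on the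
right: the product `σ * τ` is `σ` first and then `τ`. -/
def RightPerm (X : Type*) : Type _ := (Equiv.Perm X)ᵐᵒᵖ

namespace RightPerm

instance (X : Type*) : Group (RightPerm X) := inferInstanceAs (Group (Equiv.Perm X)ᵐᵒᵖ)

/-- `σ x` is the image of the point `x` under `σ` (written `x σ` for right actions). -/
instance (X : Type*) : CoeFun (RightPerm X) (fun _ => X → X) :=
  ⟨fun σ x => (MulOpposite.unop σ : Equiv.Perm X) x⟩

theorem mul_apply {X : Type*} (σ τ : RightPerm X) (x : X) : (σ * τ) x = τ (σ x) := rfl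

/-- The topology of pointwise convergence on `S(X)`, where `X` is discrete. -/
instance (X : Type*) : TopologicalSpace (RightPerm X) :=
  TopologicalSpace.induced (fun (σ : RightPerm X) (x : X) => σ x)
    (@Pi.topologicalSpace X (fun _ => X) (fun _ => ⊥))

/-- The support of a permutation. -/
def support {X : Type*} (σ : RightPerm X) : Set X := {x | σ x ≠ x}

end RightPerm

/-! A right action of a group `G` on `X` is a homomorphism `α : G →* RightPerm X`; the image of
`x` under `g` is `α g x`. -/
namespace RightAction

/-- The orbit `x G`. -/
def orbit {G X : Type*} [Group G] (α : G →* RightPerm X) (x : X) : Set X :=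
  Set.range (fun g : G => α g x)

/-- The action has infinitely many orbits. -/
def HasInfinitelyManyOrbits {G X : Type*} [Group G] (α : G →* RightPerm X) : Prop :=
  (Set.range (orbit α)).Infinite

/-- The action is free. -/
def IsFree {G X : Type*} [Group G] (α : G →* RightPerm X) : Prop :=
  ∀ (g : G) (x : X), α g x = x → g = 1

/-- The action is faithful. -/
def IsFaithful {G X : Type*} [Group G] (α : G →* RightPerm X) : Prop :=
  ∀ g : G, g ≠ 1 → (α g).support.Nonempty

/-- The action is transitive. -/
def IsTransitive {G X : Type*} [Group G] (α : G →* RightPerm X) : Prop :=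
  ∀ x y : X, ∃ g : G, α g x = y

/-- The action is highly transitive: any tuple of pairwise distinct points can be sent to any
other tuple of pairwise distinct points of the same length. -/
def IsHighlyTransitive {G X : Type*} [Group G] (α : G →* RightPerm X) : Prop :=
  ∀ (k : ℕ) (x y : Fin k → X), Function.Injective x → Function.Injective y →
    ∃ g : G, ∀ i, α g (x i) = y i

/-- The action is highly faithful: finitely many nontrivial elements always have supports
with infinite intersection. -/
def IsHighlyFaithful {G X : Type*} [Group G] (α : G →* RightPerm X) : Prop :=
  ∀ F : Finset G, (1 : G) ∉ F → (⋂ g ∈ F, (α g).support).Infinite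

end RightAction

/-- A group is highly transitive if it has a faithful highly transitive action on a countably
infinite set. -/
def IsHighlyTransitiveGroup (G : Type*) [Group G] : Prop :=
  ∃ α : G →* RightPerm ℕ, RightAction.IsFaithful α ∧ RightAction.IsHighlyTransitive α

/-- An action on a topological space is topologically free if the trivial element is the only
element that fixes a nonempty open set pointwise. -/
def IsTopologicallyFree (G Y : Type*) [Group G] [TopologicalSpace Y] [MulAction G Y] : Prop :=
  ∀ (g : G) (U : Set Y), IsOpen U → U.Nonempty → (∀ y ∈ U, g • y = y) → g = 1

/-! ### Graphs and their boundaries -/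

/-- A graph in the sense of Serre, with vertex set `V` and edge set `E`. -/
structure SerreGraph (V E : Type*) where
  /-- the antipode map -/
  bar : E → E
  /-- the source map -/
  src : E → V
  /-- the range map -/
  rng : E → V
  bar_bar : ∀ e, bar (bar e) = e
  bar_ne : ∀ e, bar e ≠ e
  src_bar : ∀ e, src (bar e) = rng e

namespace SerreGraph

/-- `G.IsPath u l v`: the sequence of edges `l` is a path from `u` to `v`
(the empty sequence being a path from each vertex to itself). -/
def IsPath {V E : Type*} (G : SerreGraph V E) : V → List E → V → Prop
  | u, [], v => u = v
  | u, e :: l, v => G.src e = u ∧ G.IsPath (G.rng e) l v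

/-- A sequence of edges is reduced if it has no backtracking. -/
def IsReduced {V E : Type*} (G : SerreGraph V E) (l : List E) : Prop :=
  l.IsChain (fun e f => f ≠ G.bar e)

/-- The distance between two vertices: the least length of a path from one to the other. -/
noncomputable def dist {V E : Type*} (G : SerreGraph V E) (u v : V) : ℕ :=
  sInf {n | ∃ l : List E, G.IsPath u l v ∧ l.length = n}

/-- The edges `f` such that some reduced path starts by `e`, does not use the antipode of `e`,
and has last edge `f`. -/
def halfGraphEdges {V E : Type*} (G : SerreGraph V E) (e : E) : Set E :=
  {f | ∃ (l : List E) (v : V), G.IsPath (G.src e) l v ∧ G.IsReduced l ∧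
    l.head? = some e ∧ G.bar e ∉ l ∧ l.getLast? = some f}

/-- The vertices of the half-graph of `e` (its half-tree, if the graph is a tree), i.e. of the
subgraph induced by `G.halfGraphEdges e`. -/
def halfGraphVertices {V E : Type*} (G : SerreGraph V E) (e : E) : Set V :=
  G.src '' G.halfGraphEdges e ∪ G.rng '' G.halfGraphEdges e

/-- A geodesic ray: an infinite path `ω = (e₀, e₁, …)` such that the distance between any two of
its vertices `ω(i) = src eᵢ` and `ω(j) = src eⱼ` is `|j - i|`. -/
@[ext]
structure GeodesicRay {V E : Type*} (G : SerreGraph V E) where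
  /-- the edges of the ray -/
  edge : ℕ → E
  isPath : ∀ k, G.rng (edge k) = G.src (edge (k + 1))
  geodesic : ∀ i k, G.dist (G.src (edge i)) (G.src (edge (i + k))) = k

/-- The range of a ray: the set of vertices that it visits. -/
def GeodesicRay.range {V E : Type*} {G : SerreGraph V E} (ω : G.GeodesicRay) : Set V :=
  Set.range (fun k => G.src (ω.edge k))

/-- Two geodesic rays are equivalent if their ranges differ by a finite set. -/
def raySetoid {V E : Type*} (G : SerreGraph V E) : Setoid G.GeodesicRay where
  r ω ω' := (symmDiff ω.range ω'.range).Finite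
  iseqv :=
    { refl := fun ω => by simp
      symm := fun {ω ω'} h => by rwa [symmDiff_comm]
      trans := fun {a b c} h h' => (h.union h').subset (symmDiff_triangle _ _ _) }

/-- The boundary of a graph (meant for trees). -/
def Boundary {V E : Type*} (G : SerreGraph V E) : Type _ := Quotient G.raySetoid

/-- The set of boundary points that are represented by a geodesic ray with range in the half-tree
of the edge `e`. -/
def boundaryOpen {V E : Type*} (G : SerreGraph V E) (e : E) : Set G.Boundary :=
  {ξ | ∃ ω : G.GeodesicRay, ω.range ⊆ G.halfGraphVertices e ∧ Quotient.mk G.raySetoid ω = ξ}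

/-- The topology on the boundary whose basic open sets are given by the half-trees. -/
instance {V E : Type*} (G : SerreGraph V E) : TopologicalSpace G.Boundary :=
  TopologicalSpace.generateFrom (Set.range G.boundaryOpen)

/-- The group `Γ` acts on the graph `G` by graph automorphisms. -/
class ActsByAutomorphisms {V E : Type*} (Γ : Type*) [Group Γ] [MulAction Γ V] [MulAction Γ E]
    (G : SerreGraph V E) : Prop where
  bar_smul : ∀ (g : Γ) (e : E), G.bar (g • e) = g • G.bar e
  src_smul : ∀ (g : Γ) (e : E), G.src (g • e) = g • G.src e
  rng_smul : ∀ (g : Γ) (e : E), G.rng (g • e) = g • G.rng e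

section action

variable {V E Γ : Type*} [Group Γ] [MulAction Γ V] [MulAction Γ E] (G : SerreGraph V E)
  [ActsByAutomorphisms Γ G]

theorem isPath_smul (g : Γ) (l : List E) (u v : V) (h : G.IsPath u l v) :
    G.IsPath (g • u) (l.map (g • ·)) (g • v) := by
  induction l generalizing u with
  | nil => exact congrArg (g • ·) h
  | cons e l ih =>
    refine ⟨?_, ?_⟩
    · rw [ActsByAutomorphisms.src_smul, h.1]
    · have := ih _ h.2
      rwa [← ActsByAutomorphisms.rng_smul] at this

theorem dist_smul (g : Γ) (u v : V) : G.dist (g • u) (g • v) = G.dist u v := by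
  unfold dist
  congr 1
  ext n
  constructor
  · rintro ⟨l, hl, hn⟩
    refine ⟨l.map (g⁻¹ • ·), ?_, by simpa using hn⟩
    simpa using G.isPath_smul g⁻¹ l _ _ hl
  · rintro ⟨l, hl, hn⟩
    exact ⟨l.map (g • ·), G.isPath_smul g l _ _ hl, by simpa using hn⟩

/-- The action on geodesic rays. -/
instance : SMul Γ G.GeodesicRay where
  smul g ω :=
    { edge := fun k => g • ω.edge k
      isPath := fun k => by
        rw [ActsByAutomorphisms.rng_smul, ActsByAutomorphisms.src_smul, ω.isPath]
      geodesic := fun i k => by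
        rw [ActsByAutomorphisms.src_smul, ActsByAutomorphisms.src_smul, dist_smul, ω.geodesic] }

theorem range_smul (g : Γ) (ω : G.GeodesicRay) : (g • ω).range = (g • ·) '' ω.range := by
  unfold GeodesicRay.range
  rw [← Set.range_comp]
  congr 1
  funext k
  exact ActsByAutomorphisms.src_smul g (ω.edge k)

/-- The action on the boundary. -/
instance : MulAction Γ G.Boundary where
  smul g := Quotient.map (g • ·) (by
    intro a b h
    change (symmDiff (g • a).range (g • b).range).Finite
    rw [range_smul, range_smul, ← Set.image_symmDiff (MulAction.injective g)]
    exact Set.Finite.image _ h)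
  one_smul ξ := by
    induction ξ using Quotient.inductionOn with
    | h ω =>
      refine congrArg (Quotient.mk _) ?_
      exact SerreGraph.GeodesicRay.ext (funext fun k => one_smul Γ _)
  mul_smul g h ξ := by
    induction ξ using Quotient.inductionOn with
    | h ω =>
      refine congrArg (Quotient.mk _) ?_
      exact SerreGraph.GeodesicRay.ext (funext fun k => mul_smul g h _)

end action

end SerreGraph

/-! ### HNN extensions and their Bass–Serre trees -/

/-- The HNN extension `⟨H, t | t⁻¹ σ t = ϑ(σ) for all σ ∈ A⟩` of an isomorphism `ϑ : A → B`
between subgroups of `H`. (Mathlib's HNN extension of `φ` has the relations `t a t⁻¹ = φ(a)`.) -/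
abbrev HNN {H : Type*} [Group H] {A B : Subgroup H} (ϑ : A ≃* B) : Type _ :=
  HNNExtension H B A ϑ.symm

namespace HNN

variable {H : Type*} [Group H] {A B : Subgroup H} (ϑ : A ≃* B)

/-- The canonical copy of `H` in the HNN extension. -/
abbrev base : Subgroup (HNN ϑ) := (HNNExtension.of : H →* HNN ϑ).range

/-- The canonical copy of `A` in the HNN extension. -/
abbrev baseA : Subgroup (HNN ϑ) := A.map HNNExtension.of

/-- The canonical copy of `B = ϑ(A)` in the HNN extension. -/
abbrev baseB : Subgroup (HNN ϑ) := B.map HNNExtension.of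

/-- The stable letter. -/
abbrev stable : HNN ϑ := HNNExtension.t

theorem relation (σ : A) :
    (stable ϑ)⁻¹ * HNNExtension.of (σ : H) * stable ϑ = HNNExtension.of (ϑ σ : H) := by
  have h := HNNExtension.t_mul_of (φ := ϑ.symm) (ϑ σ)
  rw [ϑ.symm_apply_apply] at h
  rw [mul_assoc, ← h, inv_mul_cancel_left]

/-- The antipode `γ A ↦ γ t B` of positive edges. -/
def barPos : HNN ϑ ⧸ baseA ϑ → HNN ϑ ⧸ baseB ϑ :=
  Quotient.map' (fun γ => γ * stable ϑ) (by
    intro a b h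
    rw [QuotientGroup.leftRel_apply] at h ⊢
    obtain ⟨σ, hσ, e⟩ := h
    refine ⟨ϑ ⟨σ, hσ⟩, (ϑ ⟨σ, hσ⟩).2, ?_⟩
    rw [← relation]
    simp only [e]
    group)

/-- The antipode `γ B ↦ γ t⁻¹ A` of negative edges. -/
def barNeg : HNN ϑ ⧸ baseB ϑ → HNN ϑ ⧸ baseA ϑ :=
  Quotient.map' (fun γ => γ * (stable ϑ)⁻¹) (by
    intro a b h
    rw [QuotientGroup.leftRel_apply] at h ⊢
    obtain ⟨σ, hσ, e⟩ := h
    refine ⟨ϑ.symm ⟨σ, hσ⟩, (ϑ.symm ⟨σ, hσ⟩).2, ?_⟩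
    have h := relation ϑ (ϑ.symm ⟨σ, hσ⟩)
    rw [ϑ.apply_symm_apply] at h
    rw [e] at h
    have h' := congrArg (fun z => stable ϑ * z * (stable ϑ)⁻¹) h
    simp only [mul_assoc, mul_inv_cancel, mul_one, mul_inv_cancel_left] at h'
    rw [h']
    group)

/-- The source `γ A ↦ γ H` of positive edges. -/
def srcPos : HNN ϑ ⧸ baseA ϑ → HNN ϑ ⧸ base ϑ :=
  Quotient.map' id (by
    intro a b h
    rw [QuotientGroup.leftRel_apply] at h ⊢
    exact Subgroup.map_le_range _ _ h)

/-- The source `γ B ↦ γ H` of negative edges. -/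
def srcNeg : HNN ϑ ⧸ baseB ϑ → HNN ϑ ⧸ base ϑ :=
  Quotient.map' id (by
    intro a b h
    rw [QuotientGroup.leftRel_apply] at h ⊢
    exact Subgroup.map_le_range _ _ h)

/-- The Bass–Serre tree of the HNN extension `Γ`: the vertices are the cosets `γ H`, the positive
edges are the cosets `γ A`, going from `γ H` to `γ t H`, and the negative edges are the cosets
`γ B`, going from `γ H` to `γ t⁻¹ H`; the antipode of `γ A` is `γ t B`. -/
def bassSerreTree :
    SerreGraph (HNN ϑ ⧸ base ϑ) ((HNN ϑ ⧸ baseA ϑ) ⊕ (HNN ϑ ⧸ baseB ϑ)) where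
  bar := Sum.elim (fun e => Sum.inr (barPos ϑ e)) (fun e => Sum.inl (barNeg ϑ e))
  src := Sum.elim (srcPos ϑ) (srcNeg ϑ)
  rng := Sum.elim (fun e => srcNeg ϑ (barPos ϑ e)) (fun e => srcPos ϑ (barNeg ϑ e))
  bar_bar := by
    rintro (e | e) <;> induction e using Quotient.inductionOn' with
    | h γ => simp [barPos, barNeg]
  bar_ne := by rintro (e | e) <;> simp
  src_bar := by rintro (e | e) <;> rfl

/-- The HNN extension acts on its Bass–Serre tree by left multiplication. -/
instance : SerreGraph.ActsByAutomorphisms (HNN ϑ) (bassSerreTree ϑ) where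
  bar_smul := by
    rintro g (e | e) <;> induction e using Quotient.inductionOn' with
    | h γ => simp [bassSerreTree, barPos, barNeg, mul_assoc]
  src_smul := by
    rintro g (e | e) <;> induction e using Quotient.inductionOn' with
    | h γ => rfl
  rng_smul := by
    rintro g (e | e) <;> induction e using Quotient.inductionOn' with
    | h γ => simp [bassSerreTree, barPos, barNeg, srcPos, srcNeg, mul_assoc]

/-! ### The space of actions extending a given action of `H` -/

variable {X : Type*} (π : H →* RightPerm X)

/-- The space of actions of the HNN extension on `X` which extend the action `π` of `H`; such an
action is given by the permutation `τ` by which the stable letter acts. -/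
def actions : Set (RightPerm X) := {τ | ∀ σ : A, π σ * τ = τ * π (ϑ σ)}

variable {ϑ π}

/-- The action `π_τ` of the HNN extension such that `H` acts by `π` and the stable letter
by `τ`. -/
def toAction (τ : actions ϑ π) : HNN ϑ →* RightPerm X :=
  HNNExtension.lift π τ (by
    intro b
    have h := τ.2 (ϑ.symm b)
    rw [ϑ.apply_symm_apply] at h
    exact h.symm)

theorem toAction_of (τ : actions ϑ π) (h : H) : toAction τ (HNNExtension.of h) = π h :=
  HNNExtension.lift_of _ _ _ h

theorem toAction_stable (τ : actions ϑ π) : toAction τ (stable ϑ) = τ :=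
  HNNExtension.lift_t _ _ _

variable (ϑ π)

/-- The space of transitive actions that extend `π`. -/
def transitiveActions : Set (actions ϑ π) := {τ | RightAction.IsTransitive (toAction τ)}

/-- The set of highly faithful actions that extend `π`. -/
def highlyFaithfulActions : Set (actions ϑ π) := {τ | RightAction.IsHighlyFaithful (toAction τ)}

/-- The set of highly transitive actions that extend `π`. -/
def highlyTransitiveActions : Set (actions ϑ π) :=
  {τ | RightAction.IsHighlyTransitive (toAction τ)}

end HNN

/-! The proof is a genericity argument. An action extending `π` is a permutation intertwining the
two edge groups, and it is approximated by pre-actions: partial permutations made of finitely many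
edge orbits. As `π` is free with infinitely many orbits, an undefined point can always be joined to
an untouched ("fresh") orbit. The one invariant to preserve is `Extendable`: a closed component
could never be left again. Countably many conditions, each achievable by an extendable extension,
hold simultaneously for some total action (`exists_generic`). A transitive action restricted to
finitely many edge orbits is extendable (`extendable_of_isTransitive`), so the actions built in this
way are dense among the transitive ones.

High faithfulness: a fresh point has trivial stabilizer, and it keeps it while fresh edges are
attached so that any given nontrivial elements become defined there. They then move it
(`exists_forall_moves_ne`).

High transitivity: it suffices to send a tuple to a disjoint one (`exists_moves_tuple`). Move all
the points along a common word until the next letter is undefined at each of them and they lie in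
distinct edge-group orbits. Each source can then be joined to its target through its own fresh
orbit, with the same word for all pairs.

The core is this separation (`exists_separated`). Take a reachable configuration with the greatest
number of separated pairs. Moving on along a reduced word never loses such a pair, so none is gained
either. If some point were still inside the domain, a reduced path would lead it to an undefined
state (`exists_reflTransGen`), and prolonging that path contradicts maximality. If two points stayed
in one edge-group orbit forever, the element relating them would remain in the edge groups under
conjugation along all reduced words. It would therefore fix a half-tree, hence an open set of ends,
and topological freeness makes it trivial (`eq_one_of_forall_reduced`). -/

namespace HNN

/-! ### Edge groups and signed stable letters -/

section Letters

variable {H : Type*} [Group H] {A B : Subgroup H} (ϑ : A ≃* B)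

/-- The group `A` for the sign `true`, and `B` for the sign `false`. -/
def edgeGroup (_ϑ : A ≃* B) (ε : Bool) : Subgroup H := bif ε then A else B

/-- The stable letter for the sign `true`, and its inverse for the sign `false`. -/
def letter (ε : Bool) : HNN ϑ := bif ε then stable ϑ else (stable ϑ)⁻¹

/-- The graph of the isomorphism `ϑ` for the sign `true`, and that of its inverse for the sign
`false`. -/
def Twist : Bool → H → H → Prop
  | true, a, b => ∃ h : a ∈ A, (ϑ ⟨a, h⟩ : H) = b
  | false, a, b => ∃ h : b ∈ A, (ϑ ⟨b, h⟩ : H) = a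

variable {ϑ}

theorem Twist.symm {ε : Bool} {a b : H} (h : Twist ϑ ε a b) : Twist ϑ (!ε) b a := by
  cases ε <;> exact h

theorem Twist.mem {ε : Bool} {a b : H} (h : Twist ϑ ε a b) : a ∈ edgeGroup ϑ ε := by
  cases ε
  · obtain ⟨h, rfl⟩ := h
    exact (ϑ _).2
  · exact h.1

theorem Twist.mem_right {ε : Bool} {a b : H} (h : Twist ϑ ε a b) : b ∈ edgeGroup ϑ (!ε) :=
  h.symm.mem

theorem Twist.mul {ε : Bool} {a b a' b' : H} (h : Twist ϑ ε a b) (h' : Twist ϑ ε a' b') :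
    Twist ϑ ε (a * a') (b * b') := by
  cases ε
  · obtain ⟨h, rfl⟩ := h
    obtain ⟨h', rfl⟩ := h'
    exact ⟨mul_mem h h', by rw [← Subgroup.coe_mul, ← map_mul]; rfl⟩
  · obtain ⟨h, rfl⟩ := h
    obtain ⟨h', rfl⟩ := h'
    exact ⟨mul_mem h h', by rw [← Subgroup.coe_mul, ← map_mul]; rfl⟩

theorem Twist.inv {ε : Bool} {a b : H} (h : Twist ϑ ε a b) : Twist ϑ ε a⁻¹ b⁻¹ := by
  cases ε
  · obtain ⟨h, rfl⟩ := h
    exact ⟨inv_mem h, by rw [← Subgroup.coe_inv, ← map_inv]; rfl⟩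
  · obtain ⟨h, rfl⟩ := h
    exact ⟨inv_mem h, by rw [← Subgroup.coe_inv, ← map_inv]; rfl⟩

theorem Twist.one (ε : Bool) : Twist ϑ ε 1 1 := by
  cases ε <;> exact ⟨one_mem _, congrArg Subtype.val (map_one ϑ)⟩

theorem exists_twist {ε : Bool} {a : H} (h : a ∈ edgeGroup ϑ ε) : ∃ b, Twist ϑ ε a b := by
  cases ε
  · exact ⟨ϑ.symm ⟨a, h⟩, (ϑ.symm ⟨a, h⟩).2, by simp⟩
  · exact ⟨ϑ ⟨a, h⟩, h, rfl⟩

theorem exists_twist_left {ε : Bool} {b : H} (h : b ∈ edgeGroup ϑ (!ε)) :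
    ∃ a, Twist ϑ ε a b := by
  obtain ⟨a, ha⟩ := exists_twist h
  exact ⟨a, by simpa using ha.symm⟩

theorem Twist.right_unique {ε : Bool} {a b b' : H} (h : Twist ϑ ε a b) (h' : Twist ϑ ε a b') :
    b = b' := by
  cases ε
  · obtain ⟨h, e⟩ := h
    obtain ⟨h', e'⟩ := h'
    have := ϑ.injective (Subtype.ext (e.trans e'.symm))
    exact congrArg Subtype.val this
  · obtain ⟨h, e⟩ := h
    obtain ⟨h', e'⟩ := h'
    exact e.symm.trans e'

theorem letter_not (ε : Bool) : letter ϑ (!ε) = (letter ϑ ε)⁻¹ := by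
  cases ε <;> simp [letter]

theorem Twist.of_mul_letter {ε : Bool} {a b : H} (h : Twist ϑ ε a b) :
    (HNNExtension.of a : HNN ϑ) * letter ϑ ε = letter ϑ ε * HNNExtension.of b := by
  have key : ∀ (a : H) (h : a ∈ A), (HNNExtension.of a : HNN ϑ) * stable ϑ =
      stable ϑ * HNNExtension.of (ϑ ⟨a, h⟩ : H) := by
    intro a h
    have := relation ϑ ⟨a, h⟩
    rw [← this]
    group
  cases ε
  · obtain ⟨h, rfl⟩ := h
    have := key b h
    simp only [letter, cond_false]
    rw [eq_inv_mul_iff_mul_eq, ← mul_assoc, ← this]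
    group
  · obtain ⟨h, rfl⟩ := h
    exact key a h

theorem exists_notMem_edgeGroup (hA : A ≠ ⊤) (hB : B ≠ ⊤) (ε : Bool) :
    ∃ h : H, h ∉ edgeGroup ϑ ε := by
  have : edgeGroup ϑ ε ≠ ⊤ := by cases ε <;> assumption
  by_contra! h
  exact this ((Subgroup.eq_top_iff' _).2 h)

end Letters

/-! ### Pre-actions -/

section PreAction

variable {H : Type*} [Group H] {A B : Subgroup H} {ϑ : A ≃* B} {X : Type*} {π : H →* RightPerm X}

theorem act_mul (g h : H) (x : X) : π (g * h) x = π h (π g x) := by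
  rw [map_mul]; rfl

theorem act_one (x : X) : π 1 x = x := by
  rw [map_one]; rfl

theorem act_inv_act (h : H) (x : X) : π h⁻¹ (π h x) = x := by
  rw [← act_mul, mul_inv_cancel, act_one]

theorem act_act_inv (h : H) (x : X) : π h (π h⁻¹ x) = x := by
  rw [← act_mul, inv_mul_cancel, act_one]

theorem act_injective (h : H) {x y : X} (e : π h x = π h y) : x = y := by
  rw [← act_inv_act (π := π) h x, e, act_inv_act]

theorem act_cancel (hπ : RightAction.IsFree π) {g h : H} {x : X} (e : π g x = π h x) : g = h := by
  have : π (g * h⁻¹) x = x := by rw [act_mul, e, act_inv_act]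
  exact mul_inv_eq_one.1 (hπ _ _ this)

variable (ϑ π) in
/-- A partially defined permutation by which the stable letter acts, whose domain and range consist
of finitely many orbits of the edge groups; `rel ε` is the graph of the partial map by which
`letter ϑ ε` acts. -/
structure PreAction where
  /-- the graph of the partial map for a sign -/
  rel : Bool → X → X → Prop
  symm : ∀ {ε x y}, rel ε x y → rel (!ε) y x
  unique : ∀ {ε x y y'}, rel ε x y → rel ε x y' → y = y'
  equivariant : ∀ {ε x y a b}, rel ε x y → Twist ϑ ε a b → rel ε (π a x) (π b y)
  finite : ∃ L : Set X, L.Finite ∧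
    ∀ ε x y, rel ε x y → ∃ u ∈ L, ∃ a ∈ edgeGroup ϑ ε, x = π a u

namespace PreAction

variable (R R' : PreAction ϑ π)

theorem rel_comm {ε : Bool} {x y : X} : R.rel (!ε) y x ↔ R.rel ε x y :=
  ⟨fun h => by simpa using R.symm h, R.symm⟩

theorem unique_left {ε : Bool} {x x' y : X} (h : R.rel ε x y) (h' : R.rel ε x' y) : x = x' :=
  R.unique (R.symm h) (R.symm h')

instance : Preorder (PreAction ϑ π) where
  le R R' := ∀ ε x y, R.rel ε x y → R'.rel ε x y
  le_refl _ _ _ _ h := h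
  le_trans _ _ _ h h' _ _ _ k := h' _ _ _ (h _ _ _ k)

/-- The points at which the partial map for the sign `ε` is defined. -/
def Dom (ε : Bool) (x : X) : Prop := ∃ y, R.rel ε x y

theorem dom_act_iff {ε : Bool} {a : H} (ha : a ∈ edgeGroup ϑ ε) (x : X) :
    R.Dom ε (π a x) ↔ R.Dom ε x := by
  constructor
  · rintro ⟨y, hy⟩
    obtain ⟨b, hb⟩ := exists_twist ha
    have := R.equivariant hy hb.inv
    rw [act_inv_act] at this
    exact ⟨_, this⟩
  · rintro ⟨y, hy⟩
    obtain ⟨b, hb⟩ := exists_twist ha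
    exact ⟨_, R.equivariant hy hb⟩

theorem Dom.mono {R R' : PreAction ϑ π} (h : R ≤ R') {ε : Bool} {x : X} (hx : R.Dom ε x) :
    R'.Dom ε x :=
  hx.imp fun _ => h _ _ _

/-- Moving along partially defined words: `R.Moves x g y` means that `g` has a word along which
`x` can be moved to `y`. -/
inductive Moves : X → HNN ϑ → X → Prop
  | refl (x) : Moves x 1 x
  | base {x g y} (h : H) : Moves x g y → Moves x (g * HNNExtension.of h) (π h y)
  | step {x g y z} (ε : Bool) : Moves x g y → R.rel ε y z → Moves x (g * letter ϑ ε) z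

variable {R R'}

theorem Moves.mono (h : R ≤ R') {x y : X} {g : HNN ϑ} (m : R.Moves x g y) : R'.Moves x g y := by
  induction m with
  | refl => exact .refl _
  | base k _ ih => exact .base k ih
  | step ε _ r ih => exact .step ε ih (h _ _ _ r)

theorem Moves.trans {x y z : X} {g g' : HNN ϑ} (m : R.Moves x g y) (m' : R.Moves y g' z) :
    R.Moves x (g * g') z := by
  induction m' with
  | refl => simpa using m
  | base k _ ih => rw [← mul_assoc]; exact .base k ih
  | step ε _ r ih => rw [← mul_assoc]; exact .step ε ih r

theorem moves_of (x : X) (h : H) : R.Moves x (HNNExtension.of h) (π h x) := by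
  simpa using Moves.base h (Moves.refl x)

theorem moves_letter {ε : Bool} {x y : X} (h : R.rel ε x y) : R.Moves x (letter ϑ ε) y := by
  simpa using Moves.step ε (Moves.refl x) h

theorem Moves.symm {x y : X} {g : HNN ϑ} (m : R.Moves x g y) : R.Moves y g⁻¹ x := by
  induction m with
  | refl => simpa using Moves.refl _
  | @base g y k _ ih =>
    have := moves_of (R := R) (π k y) k⁻¹
    rw [act_inv_act, map_inv] at this
    rw [mul_inv_rev]
    exact this.trans ih
  | step ε _ r ih =>
    rw [mul_inv_rev, ← letter_not]
    exact (moves_letter (R.symm r)).trans ih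

variable (R) in
/-- Two points are connected if one can be moved to the other. -/
def Conn (x y : X) : Prop := ∃ g, R.Moves x g y

theorem Conn.refl (x : X) : R.Conn x x := ⟨1, .refl x⟩
theorem Conn.symm {x y : X} : R.Conn x y → R.Conn y x := fun ⟨_, h⟩ => ⟨_, h.symm⟩
theorem Conn.trans {x y z : X} : R.Conn x y → R.Conn y z → R.Conn x z :=
  fun ⟨_, h⟩ ⟨_, h'⟩ => ⟨_, h.trans h'⟩
theorem Conn.mono (h : R ≤ R') {x y : X} : R.Conn x y → R'.Conn x y := fun ⟨_, k⟩ => ⟨_, k.mono h⟩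
theorem conn_act (x : X) (h : H) : R.Conn x (π h x) := ⟨_, moves_of x h⟩
theorem conn_rel {ε : Bool} {x y : X} (h : R.rel ε x y) : R.Conn x y := ⟨_, moves_letter h⟩

variable (R) in
/-- No component is closed: from each point one can move to a point where one of the two partial
maps is undefined. -/
def Extendable : Prop := ∀ x, ∃ c δ, R.Conn x c ∧ ¬ R.Dom δ c

variable (ϑ π) in
theorem extendable_empty :
    Extendable (⟨fun _ _ _ => False, False.elim, False.elim, fun h => h.elim,
      ∅, Set.finite_empty, fun _ _ _ h => h.elim⟩ : PreAction ϑ π) :=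
  fun x => ⟨x, true, .refl x, fun ⟨_, h⟩ => h⟩

/-! ### Adding an edge -/

variable (R) in
/-- The pre-action with one more orbit of edges, from `u` to `v` in the direction `ε`. -/
def addEdge (hπ : RightAction.IsFree π) (ε : Bool) (u v : X) (hu : ¬ R.Dom ε u)
    (hv : ¬ R.Dom (!ε) v) : PreAction ϑ π where
  rel η x y := R.rel η x y ∨
    (η = ε ∧ ∃ a b, Twist ϑ ε a b ∧ x = π a u ∧ y = π b v) ∨
    (η = !ε ∧ ∃ a b, Twist ϑ ε a b ∧ x = π b v ∧ y = π a u)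
  symm := by
    rintro η x y (h | ⟨rfl, a, b, h, rfl, rfl⟩ | ⟨rfl, a, b, h, rfl, rfl⟩)
    · exact .inl (R.symm h)
    · exact .inr (.inr ⟨rfl, a, b, h, rfl, rfl⟩)
    · exact .inr (.inl ⟨Bool.not_not _, a, b, h, rfl, rfl⟩)
  unique := by
    have hu' : ∀ a b y, Twist ϑ ε a b → ¬ R.rel ε (π a u) y := fun a b y t r =>
      hu ((R.dom_act_iff t.mem u).1 ⟨y, r⟩)
    have hv' : ∀ a b y, Twist ϑ ε a b → ¬ R.rel (!ε) (π b v) y := fun a b y t r =>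
      hv ((R.dom_act_iff t.mem_right v).1 ⟨y, r⟩)
    rintro η x y y' (h | ⟨rfl, a, b, h, rfl, rfl⟩ | ⟨rfl, a, b, h, rfl, rfl⟩)
      (h' | ⟨e, a', b', h', e', rfl⟩ | ⟨e, a', b', h', e', rfl⟩)
    · exact R.unique h h'
    · subst e e'; exact absurd h (hu' _ _ _ h')
    · subst e e'; exact absurd h (hv' _ _ _ h')
    · exact absurd h' (hu' _ _ _ h)
    -- Freeness is what makes the equivariant extension of a single new edge single-valued.
    · have := act_cancel hπ e'
      subst this
      rw [h.right_unique h']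
    · cases η <;> simp at e
    · exact absurd h' (hv' _ _ _ h)
    · cases ε <;> simp at e
    · have := act_cancel hπ e'
      subst this
      rw [h.symm.right_unique h'.symm]
  equivariant := by
    rintro η x y a₀ b₀ (h | ⟨rfl, a, b, h, rfl, rfl⟩ | ⟨rfl, a, b, h, rfl, rfl⟩) t
    · exact .inl (R.equivariant h t)
    · exact .inr (.inl ⟨rfl, _, _, h.mul t, (act_mul _ _ _).symm, (act_mul _ _ _).symm⟩)
    · refine .inr (.inr ⟨rfl, _, _, h.mul (by simpa using t.symm), (act_mul _ _ _).symm,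
        (act_mul _ _ _).symm⟩)
  finite := by
    obtain ⟨L, hL, h⟩ := R.finite
    refine ⟨insert u (insert v L), (hL.insert v).insert u, ?_⟩
    rintro η x y (h' | ⟨rfl, a, b, h', rfl, rfl⟩ | ⟨rfl, a, b, h', rfl, rfl⟩)
    · obtain ⟨w, hw, k⟩ := h _ _ _ h'
      exact ⟨w, .inr (.inr hw), k⟩
    · exact ⟨u, .inl rfl, a, h'.mem, rfl⟩
    · exact ⟨v, .inr (.inl rfl), b, h'.mem_right, rfl⟩

section addEdge

variable {hπ : RightAction.IsFree π} {ε : Bool} {u v : X} {hu : ¬ R.Dom ε u} {hv : ¬ R.Dom (!ε) v}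

theorem le_addEdge : R ≤ R.addEdge hπ ε u v hu hv := fun _ _ _ h => .inl h

theorem addEdge_rel : (R.addEdge hπ ε u v hu hv).rel ε u v :=
  .inr (.inl ⟨rfl, 1, 1, .one _, (act_one _).symm, (act_one _).symm⟩)

theorem dom_addEdge {η : Bool} {x : X} (h : (R.addEdge hπ ε u v hu hv).Dom η x) :
    R.Dom η x ∨ (η = ε ∧ ∃ a ∈ edgeGroup ϑ ε, x = π a u) ∨
      (η = (!ε) ∧ ∃ b ∈ edgeGroup ϑ (!ε), x = π b v) := by
  obtain ⟨y, h | ⟨rfl, a, b, h, rfl, rfl⟩ | ⟨rfl, a, b, h, rfl, rfl⟩⟩ := h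
  · exact .inl ⟨y, h⟩
  · exact .inr (.inl ⟨rfl, a, h.mem, rfl⟩)
  · exact .inr (.inr ⟨rfl, b, h.mem_right, rfl⟩)

/-- Only a component that meets the new edge can lose its undefined point, and it is then connected
to `u`; so one undefined point reachable from `u` is enough. -/
theorem Extendable.addEdge (hR : R.Extendable) {c : X} {δ : Bool}
    (hc : (R.addEdge hπ ε u v hu hv).Conn u c) (hδ : ¬ (R.addEdge hπ ε u v hu hv).Dom δ c) :
    (R.addEdge hπ ε u v hu hv).Extendable := by
  intro x
  obtain ⟨d, η, hd, hη⟩ := hR x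
  by_cases k : (R.addEdge hπ ε u v hu hv).Dom η d
  · refine ⟨c, δ, (hd.mono le_addEdge).trans (Conn.trans ?_ hc), hδ⟩
    obtain k | ⟨-, a, -, rfl⟩ | ⟨-, b, -, rfl⟩ := dom_addEdge k
    · exact absurd k hη
    · exact (conn_act u a).symm
    · exact (conn_act v b).symm.trans (conn_rel addEdge_rel).symm
  · exact ⟨d, η, hd.mono le_addEdge, k⟩

end addEdge

/-! ### Fresh orbits -/

variable (R) in
/-- The orbit of `z` is fresh if it meets neither the domain nor the range. -/
def Fresh (z : X) : Prop := ∀ h η, ¬ R.Dom η (π h z)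

theorem Fresh.act {z : X} (hz : R.Fresh z) (h : H) : R.Fresh (π h z) := fun k η => by
  rw [← act_mul]; exact hz _ _

theorem Fresh.not_dom {z : X} (hz : R.Fresh z) (η : Bool) : ¬ R.Dom η z := by
  have := hz 1 η
  rwa [act_one] at this

/-- The domain, the range and `K` together meet only finitely many of the infinitely many
`H`-orbits. -/
theorem exists_fresh (hinf : RightAction.HasInfinitelyManyOrbits π) (R : PreAction ϑ π)
    {K : Set X} (hK : K.Finite) : ∃ z, R.Fresh z ∧ ∀ h, π h z ∉ K := by
  obtain ⟨L, hL, hLR⟩ := R.finite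
  have hfin : (RightAction.orbit π '' (L ∪ K)).Finite := (hL.union hK).image _
  obtain ⟨_, ⟨z, rfl⟩, hz⟩ := hinf.exists_notMem_finite hfin
  have key : ∀ u ∈ L ∪ K, ∀ h, π h z ≠ u := by
    rintro _ hu h rfl
    refine hz ⟨_, hu, ?_⟩
    ext y
    constructor
    · rintro ⟨g, rfl⟩
      exact ⟨h * g, act_mul _ _ _⟩
    · rintro ⟨g, rfl⟩
      exact ⟨h⁻¹ * g, by simp only [act_mul, act_inv_act]⟩
  refine ⟨z, ?_, fun h hh => key _ (.inr hh) h rfl⟩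
  rintro h η ⟨y, hy⟩
  obtain ⟨u, hu, a, -, e⟩ := hLR _ _ _ hy
  refine key u (.inl hu) (h * a⁻¹) ?_
  rw [act_mul, e, act_inv_act]

theorem fresh_mono (h : R ≤ R') {z : X} (hz : R'.Fresh z) : R.Fresh z :=
  fun k η hd => hz k η (hd.mono h)

/-- A pre-action can be extended at a point where it is undefined. -/
theorem Extendable.addEdge_fresh {hπ : RightAction.IsFree π} {ε : Bool} {u v : X}
    {hu : ¬ R.Dom ε u} {hv : ¬ R.Dom (!ε) v} (hR : R.Extendable) (hz : R.Fresh v)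
    (huv : ∀ h, π h v ≠ u) : (R.addEdge hπ ε u v hu hv).Extendable := by
  -- At `v` the new edge uses only the direction `!ε`, so the direction `ε` stays undefined there.
  refine hR.addEdge (c := v) (δ := ε) (conn_rel addEdge_rel) fun h => ?_
  obtain h | ⟨-, a, -, e⟩ | ⟨e, -⟩ := dom_addEdge h
  · exact hz.not_dom _ h
  · exact huv a⁻¹ (by rw [e, act_inv_act])
  · cases ε <;> simp at e

end PreAction

end PreAction

end HNN

namespace HNN

/-! ### Generic actions -/

section Generic

variable {H : Type*} [Group H] {A B : Subgroup H} {ϑ : A ≃* B} {X : Type*} {π : H →* RightPerm X}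

namespace PreAction

variable {R : PreAction ϑ π}

variable (R) in
/-- The action given by `τ` extends the pre-action. -/
def Below (τ : actions ϑ π) : Prop := ∀ x y, R.rel true x y → (τ : RightPerm X) x = y

theorem Below.letter {τ : actions ϑ π} (h : R.Below τ) {ε : Bool} {x y : X} (r : R.rel ε x y) :
    toAction τ (letter ϑ ε) x = y := by
  cases ε
  · have := h _ _ (R.symm r)
    rw [HNN.letter, cond_false, map_inv, toAction_stable, ← this]
    exact Equiv.symm_apply_apply (MulOpposite.unop (τ : RightPerm X)) y
  · rw [HNN.letter, cond_true, toAction_stable]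
    exact h _ _ r

theorem Below.moves {τ : actions ϑ π} (h : R.Below τ) {x y : X} {g : HNN ϑ} (m : R.Moves x g y) :
    toAction τ g x = y := by
  induction m with
  | refl => exact act_one x
  | base k _ ih => rw [act_mul, ih, toAction_of]
  | step ε _ r ih => rw [act_mul, ih, h.letter r]

/-- Applied with both signs, this makes a generic limit total and surjective. -/
theorem exists_dom (hπ : RightAction.IsFree π) (hinf : RightAction.HasInfinitelyManyOrbits π)
    (hR : R.Extendable) (ε : Bool) (x : X) :
    ∃ R' : PreAction ϑ π, R ≤ R' ∧ R'.Extendable ∧ R'.Dom ε x := by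
  by_cases h : R.Dom ε x
  · exact ⟨R, le_rfl, hR, h⟩
  · obtain ⟨z, hz, hzx⟩ := exists_fresh hinf R (Set.finite_singleton x)
    exact ⟨R.addEdge hπ ε x z h (hz.not_dom _), le_addEdge, hR.addEdge_fresh hz hzx, z, addEdge_rel⟩

/-- The Rasiowa–Sikorski lemma for pre-actions: countably many conditions that can be achieved by
extending pre-actions are achieved simultaneously by an action. -/
theorem exists_generic [Countable X] (hπ : RightAction.IsFree π)
    (hinf : RightAction.HasInfinitelyManyOrbits π) (hR : R.Extendable) {ι : Type*} [Countable ι]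
    (D : ι → Set (PreAction ϑ π))
    (hD : ∀ i, ∀ S : PreAction ϑ π, S.Extendable →
      ∃ S' : PreAction ϑ π, S ≤ S' ∧ S'.Extendable ∧ S' ∈ D i) :
    ∃ τ : actions ϑ π, R.Below τ ∧ ∀ i, ∃ S ∈ D i, S.Below τ := by
  classical
  let P := {S : PreAction ϑ π // S.Extendable}
  let C : ι ⊕ (Bool × X) → Order.Cofinal P := Sum.elim
    (fun i => ⟨{S | S.1 ∈ D i}, fun S =>
      let ⟨S', h, h', h''⟩ := hD i S.1 S.2
      ⟨⟨S', h'⟩, h'', h⟩⟩)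
    (fun p => ⟨{S | S.1.Dom p.1 p.2}, fun S =>
      let ⟨S', h, h', h''⟩ := exists_dom hπ hinf S.2 p.1 p.2
      ⟨⟨S', h'⟩, h'', h⟩⟩)
  have := Encodable.ofCountable (ι ⊕ (Bool × X))
  let I := Order.idealOfCofinals (⟨R, hR⟩ : P) C
  have total : ∀ ε x, ∃ y, ∃ S ∈ I, S.1.rel ε x y := by
    intro ε x
    obtain ⟨S, ⟨y, hy⟩, hS⟩ := Order.cofinal_meets_idealOfCofinals (⟨R, hR⟩ : P) C (.inr (ε, x))
    exact ⟨y, S, hS, hy⟩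
  choose f hf using total
  have uniq : ∀ S ∈ I, ∀ ε x y, S.1.rel ε x y → f ε x = y := by
    intro S hS ε x y h
    obtain ⟨S', hS', h'⟩ := hf ε x
    -- Two pre-actions in the ideal have a common extension, so they cannot disagree.
    obtain ⟨T, -, hT, hT'⟩ := I.directed S hS S' hS'
    exact T.1.unique (hT' _ _ _ h') (hT _ _ _ h)
  have finv : ∀ ε x, f (!ε) (f ε x) = x := by
    intro ε x
    obtain ⟨S, hS, h⟩ := hf ε x
    exact uniq S hS _ _ _ (S.1.symm h)
  let τ : Equiv.Perm X :=
    { toFun := f true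
      invFun := f false
      left_inv := finv true
      right_inv := finv false }
  have hτ : (MulOpposite.op τ : RightPerm X) ∈ actions ϑ π := by
    intro σ
    refine MulOpposite.unop_injective (Equiv.ext fun x => ?_)
    obtain ⟨S, hS, h⟩ := hf true x
    exact uniq S hS _ _ _ (S.1.equivariant h ⟨σ.2, rfl⟩)
  have hbelow : ∀ S ∈ I, S.1.Below ⟨_, hτ⟩ := fun S hS x y h => uniq S hS _ _ _ h
  refine ⟨⟨_, hτ⟩, hbelow _ (Order.mem_idealOfCofinals _ C), fun i => ?_⟩
  obtain ⟨S, h, hS⟩ := Order.cofinal_meets_idealOfCofinals (⟨R, hR⟩ : P) C (.inl i)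
  exact ⟨S.1, h, hbelow S hS⟩

/-! ### Highly faithful extensions -/

variable (R) in
/-- No non-trivial element moves `z` to itself. -/
def TrivialStabilizer (z : X) : Prop := ∀ g, R.Moves z g z → g = 1

/-- From a fresh point no stable letter can be followed, so only elements of `H` act, and they act
freely. -/
theorem Fresh.trivialStabilizer (hπ : RightAction.IsFree π) {z : X} (hz : R.Fresh z) :
    R.TrivialStabilizer z := by
  have key : ∀ y g, R.Moves z g y → ∃ h, g = HNNExtension.of h ∧ y = π h z := by
    intro y g m
    induction m with
    | refl => exact ⟨1, by simp, (act_one z).symm⟩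
    | base k _ ih =>
      obtain ⟨h, rfl, rfl⟩ := ih
      exact ⟨h * k, by simp, (act_mul _ _ _).symm⟩
    | step ε _ r ih =>
      obtain ⟨h, rfl, rfl⟩ := ih
      exact absurd ⟨_, r⟩ (hz h ε)
  intro g m
  obtain ⟨h, rfl, e⟩ := key _ _ m
  rw [hπ _ _ e.symm, map_one]

/-- The orbit of `v` becomes a dead end: a walk entering it can leave only by backtracking through
the new edge, and this detour cancels in the group. -/
theorem TrivialStabilizer.addEdge {hπ : RightAction.IsFree π} {ε : Bool} {u v z : X}
    {hu : ¬ R.Dom ε u} {hv : ¬ R.Dom (!ε) v} (hz : R.TrivialStabilizer z) (hfv : R.Fresh v)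
    (hvu : ∀ h, π h v ≠ u) (hvz : ∀ h, π h v ≠ z) :
    (R.addEdge hπ ε u v hu hv).TrivialStabilizer z := by
  -- Either the walk is outside the orbit of `v` and its element is already realised in `R`, or it
  -- is inside and its last letter is the crossing of the new edge.
  have key : ∀ y g, (R.addEdge hπ ε u v hu hv).Moves z g y →
      ((∀ h, π h v ≠ y) ∧ R.Moves z g y) ∨
      ∃ g' h, R.Moves z g' u ∧ g = g' * letter ϑ ε * HNNExtension.of h ∧ y = π h v := by
    intro y g m
    induction m with
    | refl => exact .inl ⟨hvz, .refl z⟩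
    | @base g y k _ ih =>
      obtain ⟨h, m⟩ | ⟨g', h, m, rfl, rfl⟩ := ih
      · refine .inl ⟨fun h' e => h (h' * k⁻¹) ?_, m.base k⟩
        rw [act_mul, e, act_inv_act]
      · exact .inr ⟨g', h * k, m, by simp [mul_assoc], (act_mul _ _ _).symm⟩
    | @step g y y' η _ r ih =>
      obtain ⟨h, m⟩ | ⟨g', h, m, rfl, rfl⟩ := ih
      · obtain r | ⟨rfl, a, b, t, rfl, rfl⟩ | ⟨rfl, a, b, t, rfl, rfl⟩ := r
        · refine .inl ⟨fun k e => hfv k (!η) ?_, m.step η r⟩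
          rw [e]
          exact ⟨_, R.symm r⟩
        · refine .inr ⟨g * HNNExtension.of a⁻¹, b, ?_, ?_, rfl⟩
          · have := m.base a⁻¹
            rwa [act_inv_act] at this
          · rw [mul_assoc _ (letter ϑ η), ← t.of_mul_letter]
            simp [mul_assoc]
        · exact absurd rfl (h b)
      · obtain r | ⟨rfl, a, b, t, e, rfl⟩ | ⟨rfl, a, b, t, e, rfl⟩ := r
        · exact absurd ⟨_, r⟩ (hfv h η)
        · refine absurd ?_ (hvu (h * a⁻¹))
          rw [act_mul, e, act_inv_act]
        · obtain rfl := act_cancel hπ e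
          refine .inl ⟨fun k e => hvu (k * a⁻¹) ?_, ?_⟩
          · rw [act_mul, e, act_inv_act]
          · rw [mul_assoc g', ← t.of_mul_letter, letter_not]
            simpa [mul_assoc] using m.base a
  intro g m
  obtain ⟨-, m⟩ | ⟨g', h, m, rfl, e⟩ := key _ _ m
  · exact hz _ m
  · exact absurd e.symm (hvz h)

theorem exists_moves (hπ : RightAction.IsFree π) (hinf : RightAction.HasInfinitelyManyOrbits π)
    {z : X} (g : HNN ϑ) : ∀ R : PreAction ϑ π, R.Extendable → R.TrivialStabilizer z → ∀ x,
      ∃ R' : PreAction ϑ π, R ≤ R' ∧ R'.Extendable ∧ R'.TrivialStabilizer z ∧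
        ∃ y, R'.Moves x g y := by
  have hl : ∀ ε, ∀ R : PreAction ϑ π, R.Extendable → R.TrivialStabilizer z → ∀ x,
      ∃ R' : PreAction ϑ π, R ≤ R' ∧ R'.Extendable ∧ R'.TrivialStabilizer z ∧
        ∃ y, R'.Moves x (letter ϑ ε) y := by
    intro ε R hR hz x
    by_cases h : R.Dom ε x
    · obtain ⟨y, hy⟩ := h
      exact ⟨R, le_rfl, hR, hz, y, moves_letter hy⟩
    · obtain ⟨w, hw, hwx⟩ := exists_fresh hinf R (K := {x, z}) (by simp)
      have h1 : ∀ k, π k w ≠ x := fun k e => hwx k (.inl e)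
      have h2 : ∀ k, π k w ≠ z := fun k e => hwx k (.inr e)
      exact ⟨R.addEdge hπ ε x w h (hw.not_dom _), le_addEdge, hR.addEdge_fresh hw h1,
        hz.addEdge hw h1 h2, w, moves_letter addEdge_rel⟩
  let Q : HNN ϑ → Prop := fun g => ∀ R : PreAction ϑ π, R.Extendable → R.TrivialStabilizer z →
    ∀ x, ∃ R' : PreAction ϑ π, R ≤ R' ∧ R'.Extendable ∧ R'.TrivialStabilizer z ∧
      ∃ y, R'.Moves x g y
  have hmul : ∀ g g', Q g → Q g' → Q (g * g') := by
    intro g g' h h' R hR hz x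
    obtain ⟨R₁, l₁, hR₁, hz₁, y, m⟩ := h R hR hz x
    obtain ⟨R₂, l₂, hR₂, hz₂, w, m'⟩ := h' R₁ hR₁ hz₁ y
    exact ⟨R₂, l₁.trans l₂, hR₂, hz₂, w, (m.mono l₂).trans m'⟩
  have hof : ∀ h, Q (HNNExtension.of h) := fun h R hR hz x =>
    ⟨R, le_rfl, hR, hz, _, moves_of x h⟩
  -- `Q` is not visibly stable under inversion, so the induction carries both statements.
  suffices Q g ∧ Q g⁻¹ from this.1
  induction g using HNNExtension.induction_on with
  | of h => exact ⟨hof h, by rw [← map_inv]; exact hof _⟩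
  | t => exact ⟨hl true, hl false⟩
  | mul g g' h h' => exact ⟨hmul _ _ h.1 h'.1, by rw [mul_inv_rev]; exact hmul _ _ h'.2 h.2⟩
  | inv g h => exact ⟨h.2, by rw [inv_inv]; exact h.1⟩

/-- A fresh point outside `K` keeps a trivial stabilizer while words for all of `F` are made defined
at it, so no element of `F` can bring it back. -/
theorem exists_forall_moves_ne (hπ : RightAction.IsFree π)
    (hinf : RightAction.HasInfinitelyManyOrbits π) (hR : R.Extendable) (F : Finset (HNN ϑ))
    (hF : (1 : HNN ϑ) ∉ F) {K : Set X} (hK : K.Finite) :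
    ∃ R' : PreAction ϑ π, R ≤ R' ∧ R'.Extendable ∧ ∃ z ∉ K, ∀ g ∈ F, ∃ y ≠ z, R'.Moves z g y := by
  classical
  obtain ⟨z, hz, hzK⟩ := exists_fresh hinf R hK
  have key : ∀ F : Finset (HNN ϑ), ∃ R' : PreAction ϑ π, R ≤ R' ∧ R'.Extendable ∧
      R'.TrivialStabilizer z ∧ ∀ g ∈ F, ∃ y, R'.Moves z g y := by
    intro F
    induction F using Finset.induction_on with
    | empty => exact ⟨R, le_rfl, hR, hz.trivialStabilizer hπ, by simp⟩
    | insert g F _ ih =>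
      obtain ⟨R₁, l₁, hR₁, hz₁, h⟩ := ih
      obtain ⟨R₂, l₂, hR₂, hz₂, h'⟩ := exists_moves hπ hinf g R₁ hR₁ hz₁ z
      refine ⟨R₂, l₁.trans l₂, hR₂, hz₂, fun k hk => ?_⟩
      obtain rfl | hk := Finset.mem_insert.1 hk
      · exact h'
      · exact (h k hk).imp fun _ m => m.mono l₂
  obtain ⟨R', l, hR', hs, h⟩ := key F
  refine ⟨R', l, hR', z, ?_, fun g hg => ?_⟩
  · have := hzK 1
    rwa [act_one] at this
  · obtain ⟨y, m⟩ := h g hg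
    refine ⟨y, ?_, m⟩
    rintro rfl
    exact hF (hs g m ▸ hg)

end PreAction

end Generic

end HNN

namespace HNN

/-! ### Reduced moves -/

section Reduced

variable {H : Type*} [Group H] {A B : Subgroup H} {ϑ : A ≃* B} {X : Type*} {π : H →* RightPerm X}

variable (ϑ) in
/-- The word `letter ϑ ε * h * letter ϑ δ` is reduced. -/
def Reduced (ε : Bool) (h : H) (δ : Bool) : Prop := δ = ε ∨ h ∉ edgeGroup ϑ (!ε)

theorem not_reduced {ε : Bool} {h : H} {δ : Bool} (k : ¬ Reduced ϑ ε h δ) :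
    δ = (!ε) ∧ h ∈ edgeGroup ϑ (!ε) := by
  rw [Reduced, not_or, not_not] at k
  exact ⟨by cases ε <;> cases δ <;> simp_all, k.2⟩

theorem Reduced.mul {ε : Bool} {h a : H} {δ : Bool} (k : Reduced ϑ ε h δ)
    (ha : a ∈ edgeGroup ϑ δ) : Reduced ϑ ε (h * a) δ := by
  by_contra k'
  obtain ⟨rfl, hm⟩ := not_reduced k'
  obtain k | k := k
  · cases ε <;> simp at k
  · exact k ((Subgroup.mul_mem_cancel_right _ ha).1 hm)

namespace PreAction

variable (R : PreAction ϑ π)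

/-- A state `(x, ε)` is a point `x` which is to be moved by `letter ϑ ε`; it advances to the next
state by a move followed by the action of an element of `H`, without backtracking. -/
def Adv (s s' : X × Bool) : Prop :=
  ∃ y h, R.rel s.2 s.1 y ∧ s'.1 = π h y ∧ Reduced ϑ s.2 h s'.2

variable {R}

theorem Adv.mono {R' : PreAction ϑ π} (l : R ≤ R') {s s' : X × Bool} (h : R.Adv s s') :
    R'.Adv s s' := by
  obtain ⟨y, h, r, k⟩ := h
  exact ⟨y, h, l _ _ _ r, k⟩

variable (ϑ π) in
/-- Two states are equivalent if they differ by an element of the edge group. -/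
def stateSetoid : Setoid (X × Bool) where
  r s s' := s.2 = s'.2 ∧ ∃ a ∈ edgeGroup ϑ s.2, s'.1 = π a s.1
  iseqv :=
    { refl := fun s => ⟨rfl, 1, one_mem _, (act_one _).symm⟩
      symm := by
        rintro ⟨x, ε⟩ ⟨y, _⟩ ⟨rfl, a, ha, rfl⟩
        exact ⟨rfl, a⁻¹, inv_mem ha, (act_inv_act _ _).symm⟩
      trans := by
        rintro ⟨x, ε⟩ ⟨y, _⟩ ⟨z, _⟩ ⟨rfl, a, ha, rfl⟩ ⟨rfl, b, hb, rfl⟩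
        exact ⟨rfl, a * b, mul_mem ha hb, (act_mul _ _ _).symm⟩ }

theorem finite_states (R : PreAction ϑ π) :
    (Quotient.mk (stateSetoid ϑ π) '' {s | R.Dom s.2 s.1}).Finite := by
  obtain ⟨L, hL, h⟩ := R.finite
  refine ((hL.prod Set.finite_univ).image (Quotient.mk (stateSetoid ϑ π))).subset ?_
  rintro _ ⟨⟨x, ε⟩, ⟨y, hy⟩, rfl⟩
  obtain ⟨u, hu, a, ha, e⟩ := h _ _ _ hy
  exact ⟨(u, ε), ⟨hu, trivial⟩, Quotient.sound ⟨rfl, a, ha, e⟩⟩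

/-- In an extendable pre-action, reduced moves lead from each state to an undefined one. -/
theorem Extendable.exists_reflTransGen (hπ : RightAction.IsFree π) (hA : A ≠ ⊤) (hB : B ≠ ⊤)
    (hR : R.Extendable) (s₀ : X × Bool) : ∃ s, Relation.ReflTransGen R.Adv s₀ s ∧ ¬ R.Dom s.2 s.1 := by
  classical
  by_contra! hall
  -- At least one step is required: a state of `S` then has a last move, whose `H`-part can absorb
  -- an edge-group element, so `S` is saturated under the edge groups.
  let S : Set (X × Bool) := {s | Relation.TransGen R.Adv s₀ s}
  have hdom : ∀ s, ∃ y, s ∈ S → R.rel s.2 s.1 y := fun s => by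
    by_cases hs : s ∈ S
    · obtain ⟨y, hy⟩ := hall s hs.to_reflTransGen
      exact ⟨y, fun _ => hy⟩
    · exact ⟨s.1, fun h => absurd h hs⟩
  choose n hn using hdom
  have closed : ∀ {s s'}, s ∈ S → R.Adv s s' → s' ∈ S := fun hs h => hs.tail h
  have sat : ∀ {x δ a}, (x, δ) ∈ S → a ∈ edgeGroup ϑ δ → (π a x, δ) ∈ S := by
    intro x δ a hs ha
    obtain ⟨⟨y, ε⟩, h₀, z, h, r, e, k⟩ := Relation.TransGen.tail'_iff.1 hs
    refine Relation.TransGen.tail' h₀ ⟨z, h * a, r, ?_, k.mul ha⟩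
    rw [act_mul, ← e]
  have next : ∀ {s}, s ∈ S → ∀ h δ', Reduced ϑ s.2 h δ' → (π h (n s), δ') ∈ S :=
    fun hs h δ' k => closed hs ⟨_, h, hn _ hs, rfl, k⟩
  have same : ∀ {s s'}, s ∈ S → s' ∈ S → s.2 = s'.2 → ∀ k ∈ edgeGroup ϑ (!s.2),
      n s' = π k (n s) → stateSetoid ϑ π s s' := by
    rintro ⟨x, δ⟩ ⟨x', _⟩ hs hs' rfl k hk e
    obtain ⟨a, t⟩ := exists_twist_left hk
    refine ⟨rfl, a, t.mem, ?_⟩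
    have h1 := R.equivariant (hn _ hs) t
    have h2 := hn _ hs'
    rw [e] at h2
    exact R.unique_left h2 h1
  -- If the backtracking state at the end of `s` is not in `S`, then any other edge of `S` arriving
  -- in the same `H`-orbit could reach that state by a reduced turn; so there is no such edge.
  have same' : ∀ {s s'}, s ∈ S → s' ∈ S → ∀ k, n s' = π k (n s) → (n s, !s.2) ∉ S →
      stateSetoid ϑ π s s' := by
    intro s s' hs hs' k e hb
    by_cases hk : Reduced ϑ s'.2 k⁻¹ (!s.2)
    · have := next hs' _ _ hk
      rw [e, act_inv_act] at this
      exact absurd this hb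
    · obtain ⟨h1, h2⟩ := not_reduced hk
      have h1 : s.2 = s'.2 := by simpa using h1
      exact same hs hs' h1 k (by rw [h1]; simpa using h2) e
  have hone : ∀ {s}, s ∈ S → (n s, s.2) ∈ S := by
    intro s hs
    have := next hs 1 s.2 (.inl rfl)
    rwa [act_one] at this
  let T : Set (Quotient (stateSetoid ϑ π)) := Quotient.mk _ '' S
  have hT : Finite T := (R.finite_states.subset (Set.image_mono fun s hs => ⟨_, hn s hs⟩)).to_subtype
  have hrep : ∀ q : T, ∃ s, s ∈ S ∧ Quotient.mk _ s = q.1 := fun q => q.2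
  choose rep hrepS hrep using hrep
  -- A self-map of the finite set of classes of `S`: cross the edge, then turn back if that state
  -- lies in `S`, and otherwise go on in the same direction. It is injective, hence onto.
  let img : T → X × Bool := fun q =>
    (n (rep q), if (n (rep q), !(rep q).2) ∈ S then !(rep q).2 else (rep q).2)
  have himg : ∀ q, img q ∈ S := fun q => by
    dsimp only [img]
    split_ifs with h
    · exact h
    · exact hone (hrepS q)
  let Φ : T → T := fun q => ⟨Quotient.mk _ (img q), img q, himg q, rfl⟩
  have hΦ : Function.Injective Φ := by
    intro q q' e
    obtain ⟨e1, k, hk, e2⟩ := Quotient.exact (congrArg Subtype.val e)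
    have goal : stateSetoid ϑ π (rep q) (rep q') → q = q' := fun h =>
      Subtype.ext ((hrep q).symm.trans ((Quotient.sound h).trans (hrep q')))
    apply goal
    by_cases h : (n (rep q), !(rep q).2) ∈ S
    · by_cases h' : (n (rep q'), !(rep q').2) ∈ S
      · simp only [img, if_pos h, if_pos h'] at e1 hk
        exact same (hrepS q) (hrepS q') (by simpa using e1) k hk e2
      · refine (stateSetoid ϑ π).symm (same' (hrepS q') (hrepS q) k⁻¹ ?_ h')
        rw [show n (rep q') = π k (n (rep q)) from e2, act_inv_act]
    · exact same' (hrepS q) (hrepS q') k e2 h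
  have hsurj := Finite.surjective_of_injective hΦ
  have hbar : ∀ {s}, s ∈ S → (n s, !s.2) ∈ S := by
    intro s hs
    -- A reduced turn by `h` gives a state of `S` in the same `H`-orbit. By surjectivity it comes
    -- from some edge arriving there, which by `same'` is the edge of `s`; this forces `h` into the
    -- edge group.
    by_contra hb
    obtain ⟨h, hh⟩ := exists_notMem_edgeGroup (ϑ := ϑ) hA hB (!s.2)
    have hs' := next hs h (!s.2) (.inr hh)
    obtain ⟨q, hq⟩ := hsurj ⟨_, _, hs', rfl⟩
    obtain ⟨e1, k, hk, e2⟩ := Quotient.exact (congrArg Subtype.val hq)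
    have e3 : n (rep q) = π (h * k⁻¹) (n s) := by
      rw [act_mul, show π h (n s) = π k (n (rep q)) from e2, act_inv_act]
    obtain ⟨e4, a, ha, e5⟩ := same' hs (hrepS q) _ e3 hb
    obtain ⟨b, t⟩ := exists_twist ha
    have e6 : n (rep q) = π b (n s) := by
      refine R.unique (hn _ (hrepS q)) ?_
      rw [← e4, e5]
      exact R.equivariant (hn _ hs) t
    have e7 : h * k⁻¹ = b := act_cancel hπ (e3.symm.trans e6)
    have e1 : (img q).2 = !s.2 := e1
    rw [e1] at hk
    exact hh ((Subgroup.mul_mem_cancel_right _ (inv_mem hk)).1 (e7 ▸ t.mem_right))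
  -- Backtracking is now allowed, so crossing an edge and returning reaches all the states over the
  -- orbit of `x`. Thus `S` fills a whole component, which is closed, against extendability.
  have full : ∀ {x δ}, (x, δ) ∈ S → ∀ h δ', (π h x, δ') ∈ S := by
    intro x δ hs h δ'
    by_cases k : Reduced ϑ (!δ) h δ'
    · exact closed (hbar hs) ⟨x, h, R.symm (hn _ hs), rfl, k⟩
    · obtain ⟨h1, h2⟩ := not_reduced k
      rw [Bool.not_not] at h1 h2
      subst h1
      exact sat hs h2
  have hV : ∀ {x y g}, R.Moves x g y → (∀ δ, (x, δ) ∈ S) → ∀ δ, (y, δ) ∈ S := by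
    intro x y g m hx
    induction m with
    | refl => exact hx
    | base h _ ih => exact fun δ => full (ih true) h δ
    | step ε _ r ih =>
      intro δ
      have h1 := hbar (ih ε)
      rw [show n _ = _ from R.unique (hn _ (ih ε)) r] at h1
      have := full h1 1 δ
      rwa [act_one] at this
  obtain ⟨y, hy⟩ := hall s₀ .refl
  have hy : (y, s₀.2) ∈ S := .single ⟨y, 1, hy, (act_one _).symm, .inl rfl⟩
  have hy' : ∀ δ, (y, δ) ∈ S := fun δ => by
    have := full hy 1 δ
    rwa [act_one] at this
  obtain ⟨c, δ, ⟨g, m⟩, hc⟩ := hR y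
  exact hc ⟨_, hn _ (hV m hy' δ)⟩

end PreAction

end Reduced

end HNN

namespace HNN

/-! ### Separating points -/

section Separate

variable {H : Type*} [Group H] {A B : Subgroup H} {ϑ : A ≃* B} {X : Type*} {π : H →* RightPerm X}

namespace PreAction

/-- A pre-action can be extended by fresh edges at finitely many points. -/
theorem Extendable.exists_advance {R : PreAction ϑ π} (hπ : RightAction.IsFree π)
    (hinf : RightAction.HasInfinitelyManyOrbits π) (hR : R.Extendable) (ε : Bool) (Q : Finset X)
    {K : Set X} (hK : K.Finite) :
    ∃ R' : PreAction ϑ π, R ≤ R' ∧ R'.Extendable ∧ (∀ x ∈ Q, R'.Dom ε x) ∧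
      (∀ x y, R'.rel ε x y → ¬ R.Dom ε x → R.Fresh y ∧ ∀ h, π h y ∉ K) ∧
      (∀ x, R'.Dom ε x → ¬ R.Dom ε x → ∃ u ∈ Q, ∃ a ∈ edgeGroup ϑ ε, x = π a u) ∧
      ∀ x x' y h, R'.rel ε x y → R'.rel ε x' (π h y) → ¬ R.Dom ε x → ¬ R.Dom ε x' →
        ∃ a ∈ edgeGroup ϑ ε, x' = π a x := by
  classical
  induction Q using Finset.induction_on with
  | empty =>
    exact ⟨R, le_rfl, hR, by simp, fun x y h h' => absurd ⟨y, h⟩ h', fun x h h' => absurd h h',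
      fun x x' y h h1 _ h2 => absurd ⟨y, h1⟩ h2⟩
  | insert u Q _ ih =>
    obtain ⟨R', l, hR', h1, h2, h3, h4⟩ := ih
    by_cases hu : R'.Dom ε u
    · refine ⟨R', l, hR', fun x hx => ?_, h2, fun x hx hx' => ?_, h4⟩
      · obtain rfl | hx := Finset.mem_insert.1 hx
        exacts [hu, h1 x hx]
      · obtain ⟨v, hv, k⟩ := h3 x hx hx'
        exact ⟨v, Finset.mem_insert_of_mem hv, k⟩
    -- A new fresh orbit for each edge added: this keeps different edge-group orbits from arriving
    -- in one `H`-orbit.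
    · obtain ⟨z, hz, hzK⟩ := exists_fresh hinf R' (hK.insert u)
      have hrel : ∀ {x y}, (R'.addEdge hπ ε u z hu (hz.not_dom _)).rel ε x y → R'.rel ε x y ∨
          ∃ a b, Twist ϑ ε a b ∧ x = π a u ∧ y = π b z := by
        rintro x y (h | ⟨-, h⟩ | ⟨h, -⟩)
        · exact .inl h
        · exact .inr h
        · cases ε <;> simp at h
      refine ⟨R'.addEdge hπ ε u z hu (hz.not_dom _), l.trans le_addEdge,
        hR'.addEdge_fresh hz fun h e => hzK h (.inl e), fun x hx => ?_, fun x y r hx => ?_,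
        fun x hx hx' => ?_, fun x x' y h r r' hx hx' => ?_⟩
      · obtain rfl | hx := Finset.mem_insert.1 hx
        exacts [⟨z, addEdge_rel⟩, (h1 x hx).mono le_addEdge]
      · obtain r | ⟨a, b, -, rfl, rfl⟩ := hrel r
        · exact h2 x y r hx
        · refine ⟨(fresh_mono l hz).act b, fun h hh => hzK (b * h) (.inr ?_)⟩
          rwa [act_mul]
      · obtain ⟨y, r⟩ := hx
        obtain r | ⟨a, b, t, rfl, rfl⟩ := hrel r
        · obtain ⟨v, hv, k⟩ := h3 x ⟨y, r⟩ hx'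
          exact ⟨v, Finset.mem_insert_of_mem hv, k⟩
        · exact ⟨u, Finset.mem_insert_self _ _, a, t.mem, rfl⟩
      · obtain r | ⟨a, b, t, rfl, rfl⟩ := hrel r
        · obtain r' | ⟨a', b', t', rfl, e⟩ := hrel r'
          · exact h4 x x' y h r r' hx hx'
          · have hy : y = π (b' * h⁻¹) z := by rw [act_mul, ← e, act_inv_act]
            exact absurd ⟨x, hy ▸ R'.symm r⟩ (hz (b' * h⁻¹) (!ε))
        · obtain r' | ⟨a', b', t', rfl, e⟩ := hrel r'
          · rw [← act_mul] at r'
            exact absurd ⟨x', R'.symm r'⟩ (hz _ _)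
          · refine ⟨a⁻¹ * a', mul_mem (inv_mem t.mem) t'.mem, ?_⟩
            rw [act_mul, act_inv_act]

variable {ι : Type*} [Finite ι]

/-- The pre-action `R` extends `R₀`, and a group element moves the points `p i` to the points
`q i`. -/
structure Reach (R₀ : PreAction ϑ π) (p : ι → X) (R : PreAction ϑ π) (q : ι → X) : Prop where
  le : R₀ ≤ R
  extendable : R.Extendable
  injective : Function.Injective q
  moves : ∃ g, ∀ i, R.Moves (p i) g (q i)

/-- The pairs of points at which the pre-action is undefined and which lie in distinct orbits of
the edge group (or coincide). -/
def sepPairs (R : PreAction ϑ π) (ε : Bool) (q : ι → X) : Set (ι × ι) :=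
  {ij | ¬ R.Dom ε (q ij.1) ∧ ¬ R.Dom ε (q ij.2) ∧
    (ij.1 = ij.2 ∨ ∀ a ∈ edgeGroup ϑ ε, q ij.2 ≠ π a (q ij.1))}

/-- One common step of the configuration. Undefined points go to fresh orbits, distinct for distinct
edge-group orbits, so after a reduced turn they are still undefined and separated pairs stay
separated. The set `K` marks points that the fresh orbits must avoid. -/
theorem Reach.advance {R₀ R : PreAction ϑ π} {p q : ι → X} (hπ : RightAction.IsFree π)
    (hinf : RightAction.HasInfinitelyManyOrbits π) (hr : Reach R₀ p R q) (ε : Bool)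
    {K : Set X} (hK : K.Finite) :
    ∃ (R' : PreAction ϑ π) (q' : ι → X), R ≤ R' ∧ (∀ i, R'.rel ε (q i) (q' i)) ∧
      (∀ h δ, Reduced ϑ ε h δ → Reach R₀ p R' (fun i => π h (q' i)) ∧
        R.sepPairs ε q ⊆ R'.sepPairs δ (fun i => π h (q' i)) ∧
        ∀ i, ¬ R.Dom ε (q i) → ¬ R'.Dom δ (π h (q' i))) ∧
      (∀ i, ¬ R.Dom ε (q i) → ∀ h, π h (q' i) ∉ K) ∧
      ∀ c ∈ K, ∀ δ, R'.Dom δ c → ¬ R.Dom δ c →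
        δ = ε ∧ ∃ i, ∃ a ∈ edgeGroup ϑ ε, c = π a (q i) := by
  classical
  have := Fintype.ofFinite ι
  -- Avoiding the range of `q` too prevents a new edge from starting in a fresh target orbit.
  obtain ⟨R', l, hR', h1, h2, h3, h4⟩ := hr.extendable.exists_advance hπ hinf ε
    (Finset.univ.image q) (hK.union (Set.finite_range q))
  choose q' hq' using fun i => h1 (q i) (Finset.mem_image_of_mem q (Finset.mem_univ i))
  have hopen : ∀ h δ, Reduced ϑ ε h δ → ∀ i, ¬ R.Dom ε (q i) → ¬ R'.Dom δ (π h (q' i)) := by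
    intro h δ hh i hi hd
    obtain ⟨hfr, hnK⟩ := h2 _ _ (hq' i) hi
    by_cases e : δ = ε
    · subst e
      obtain ⟨u, hu, a, -, e⟩ := h3 _ hd (hfr h δ)
      obtain ⟨j, -, rfl⟩ := Finset.mem_image.1 hu
      refine hnK (h * a⁻¹) (.inr ⟨j, ?_⟩)
      rw [act_mul, e, act_inv_act]
    · obtain rfl : δ = !ε := by cases ε <;> cases δ <;> simp_all
      obtain ⟨x, r⟩ := hd
      have hx : ¬ R.Dom ε x := fun ⟨y, r'⟩ => hfr h (!ε) ⟨x, by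
        rw [R'.unique (R'.rel_comm.1 r) (l _ _ _ r')]
        exact R.symm r'⟩
      obtain ⟨a, ha, rfl⟩ := h4 _ _ _ h (hq' i) (R'.rel_comm.1 r) hi hx
      obtain ⟨b, t⟩ := exists_twist ha
      have := act_cancel hπ (R'.unique (R'.rel_comm.1 r) (R'.equivariant (hq' i) t))
      subst this
      exact hh.resolve_left (by cases ε <;> simp) t.mem_right
  refine ⟨R', q', l, hq', fun h δ hh => ⟨⟨hr.le.trans l, hR', ?_, ?_⟩, ?_, hopen h δ hh⟩,
    fun i hi h hh => (h2 _ _ (hq' i) hi).2 h (.inl hh), fun c hc δ hd hd' => ?_⟩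
  · intro i j e
    have e : q' i = q' j := act_injective h e
    have := hq' i
    rw [e] at this
    exact hr.injective (R'.unique_left this (hq' j))
  · obtain ⟨g, m⟩ := hr.moves
    exact ⟨_, fun i => (((m i).mono l).step ε (hq' i)).base h⟩
  · rintro ⟨i, j⟩ ⟨hi, hj, hij⟩
    refine ⟨hopen h δ hh i hi, hopen h δ hh j hj, hij.imp_right fun hij a ha e => ?_⟩
    have e' : q' j = π (h * a * h⁻¹) (q' i) := by
      have e : π h (q' j) = π a (π h (q' i)) := e
      rw [act_mul, act_mul, ← e, act_inv_act]
    have r := hq' j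
    rw [e'] at r
    obtain ⟨b, hb, k⟩ := h4 _ _ _ _ (hq' i) r hi hj
    exact hij b hb k
  · by_cases e : δ = ε
    · subst e
      obtain ⟨u, hu, k⟩ := h3 c hd hd'
      obtain ⟨j, -, rfl⟩ := Finset.mem_image.1 hu
      exact ⟨rfl, j, k⟩
    · obtain rfl : δ = !ε := by cases ε <;> cases δ <;> simp_all
      obtain ⟨x, r⟩ := hd
      have hx : ¬ R.Dom ε x := fun ⟨y, r'⟩ => hd' ⟨x, by
        rw [R'.unique (R'.rel_comm.1 r) (l _ _ _ r')]
        exact R.symm r'⟩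
      have := (h2 _ _ (R'.rel_comm.1 r) hx).2 1
      rw [act_one] at this
      exact absurd (.inl hc) this

/-- Reachable configurations with the greatest possible number of separated pairs. -/
structure MaxReach (R₀ : PreAction ϑ π) (p : ι → X) (R : PreAction ϑ π) (ε : Bool)
    (q : ι → X) : Prop extends Reach R₀ p R q where
  max : ∀ R' δ q', Reach R₀ p R' q' → (R'.sepPairs δ q').ncard ≤ (R.sepPairs ε q).ncard

theorem exists_maxReach {R₀ : PreAction ϑ π} (hR : R₀.Extendable) {p : ι → X}
    (hp : Function.Injective p) : ∃ R ε q, MaxReach R₀ p R ε q := by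
  let P : ℕ → Prop := fun n => ∃ R ε q, Reach R₀ p R q ∧ (R.sepPairs ε q).ncard = n
  have hP : ∃ n, P n :=
    ⟨_, R₀, true, p, ⟨le_rfl, hR, hp, 1, fun i => .refl _⟩, rfl⟩
  have hb : ∀ n, P n → n ≤ Nat.card (ι × ι) := by
    rintro _ ⟨R, ε, q, -, rfl⟩
    exact Set.ncard_le_card _
  classical
  obtain ⟨n, hn⟩ := hP
  obtain ⟨R, ε, q, h, e⟩ := Nat.findGreatest_spec (hb n hn) hn
  refine ⟨R, ε, q, h, fun R' δ q' h' => ?_⟩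
  rw [e]
  exact Nat.le_findGreatest (hb _ ⟨R', δ, q', h', rfl⟩) ⟨R', δ, q', h', rfl⟩

/-- A step that loses no separated pair cannot gain one at the maximum; the diagonal pairs show that
the indices of the undefined points do not change either. -/
theorem MaxReach.of_subset {R₀ R R' : PreAction ϑ π} {p q q' : ι → X} {ε δ : Bool}
    (h : MaxReach R₀ p R ε q) (h' : Reach R₀ p R' q')
    (hs : R.sepPairs ε q ⊆ R'.sepPairs δ q') :
    MaxReach R₀ p R' δ q' ∧ R'.sepPairs δ q' = R.sepPairs ε q := by
  have := Set.eq_of_subset_of_ncard_le hs (h.max _ _ _ h')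
  refine ⟨⟨h', ?_⟩, this.symm⟩
  rw [← this]
  exact h.max

/-- Otherwise, advancing the configuration one step along the path leaves the end `s'` undefined,
and by induction `s'` is then in the edge-group orbit of an undefined new point. By maximality that
index was undefined before the step, so its new point lies in a fresh orbit chosen to avoid `s'`. -/
theorem MaxReach.eq_of_reflTransGen {R₀ R₁ : PreAction ϑ π} {p : ι → X}
    (hπ : RightAction.IsFree π) (hinf : RightAction.HasInfinitelyManyOrbits π)
    {s s' : X × Bool} (hs : Relation.ReflTransGen R₁.Adv s s') :
    ∀ (R : PreAction ϑ π) (q : ι → X), MaxReach R₀ p R s.2 q → R₁ ≤ R → ∀ i, q i = s.1 →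
      ¬ R.Dom s'.2 s'.1 →
      s'.2 = s.2 ∧ ∃ j, ¬ R.Dom s.2 (q j) ∧ ∃ a ∈ edgeGroup ϑ s.2, s'.1 = π a (q j) := by
  induction hs using Relation.ReflTransGen.head_induction_on with
  | refl =>
    rintro R q - - i hi hd
    exact ⟨rfl, i, by rwa [hi], 1, one_mem _, by rw [act_one, hi]⟩
  | @head s s₁ h _ ih =>
    intro R q hm l i hi hd
    obtain ⟨y, h, r, e, hh⟩ := h
    by_contra hne
    obtain ⟨R', q', l', hq', hadv, hK, hc⟩ :=
      hm.advance hπ hinf s.2 (Set.finite_singleton s'.1)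
    obtain ⟨hreach, hsub, -⟩ := hadv h s₁.2 hh
    obtain ⟨hm', heq⟩ := hm.of_subset hreach hsub
    have hy : q' i = y := R'.unique (hq' i) (by rw [hi]; exact l' _ _ _ (l _ _ _ r))
    obtain ⟨-, j, hj, a, -, ha⟩ := ih R' _ hm' (l.trans l') i (by rw [hy, e]) (fun hd' => by
      obtain ⟨e₁, j, a, ha, e₂⟩ := hc _ rfl _ hd' hd
      refine hne ⟨e₁, j, fun hj => hd ?_, a, ha, e₂⟩
      rw [e₁, e₂, R.dom_act_iff ha]
      exact hj)
    have hj' : (j, j) ∈ R.sepPairs s.2 q := by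
      rw [← heq]
      exact ⟨hj, hj, .inl rfl⟩
    refine hK j hj'.1 (h * a) ?_
    rw [act_mul]
    exact ha.symm

/-- In a maximal configuration the pre-action is undefined at all points. -/
theorem MaxReach.not_dom {R₀ R : PreAction ϑ π} {p q : ι → X} {ε : Bool}
    (hπ : RightAction.IsFree π) (hinf : RightAction.HasInfinitelyManyOrbits π)
    (hA : A ≠ ⊤) (hB : B ≠ ⊤) (hm : MaxReach R₀ p R ε q) (i : ι) : ¬ R.Dom ε (q i) := by
  intro hi
  obtain ⟨s', hs', hd⟩ := hm.extendable.exists_reflTransGen hπ hA hB (q i, ε)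
  obtain ⟨e, j, hj, a, ha, e'⟩ := MaxReach.eq_of_reflTransGen hπ hinf hs' R q hm le_rfl i rfl hd
  obtain rfl | ⟨s₁, ⟨y, h, r, e₁, hh⟩, hs₁⟩ := Relation.ReflTransGen.cases_head hs'
  · exact hd hi
  obtain ⟨R', q', l', hq', hadv, -⟩ := hm.advance hπ hinf ε Set.finite_empty
  obtain ⟨hreach, hsub, -⟩ := hadv h s₁.2 hh
  obtain ⟨hm', -⟩ := hm.of_subset hreach hsub
  have hy : q' i = y := R'.unique (hq' i) (l' _ _ _ r)
  -- After one step, the edge just added at `q j` prolongs the path beyond `s'`. The sign of the new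
  -- end is free, because `k` lies outside the edge group; taking it opposite to that of `s₁`
  -- contradicts the sign equality of `MaxReach.eq_of_reflTransGen`.
  obtain ⟨k, hk⟩ : ∃ k, Reduced ϑ ε k (!s₁.2) := by
    obtain ⟨k, hk⟩ := exists_notMem_edgeGroup (ϑ := ϑ) hA hB (!ε)
    exact ⟨k, .inr hk⟩
  obtain ⟨b, t⟩ := exists_twist ha
  have hadv' : R'.Adv s' (π k (q' j), !s₁.2) := by
    refine ⟨π b (q' j), b⁻¹ * k, ?_, ?_, ?_⟩
    · rw [e, e']
      exact R'.equivariant (hq' j) t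
    · rw [← act_mul, mul_inv_cancel_left]
    · rw [e]
      refine hk.imp_right fun hk hb => hk ?_
      exact (Subgroup.mul_mem_cancel_left _ (inv_mem t.mem_right)).1 hb
  have := MaxReach.eq_of_reflTransGen hπ hinf
    ((Relation.ReflTransGen.mono (fun _ _ => Adv.mono l') _ _ hs₁).tail hadv') R' _ hm' le_rfl i (by rw [hy, e₁])
    ((hadv k _ hk).2.2 j hj)
  simp at this

/-- Distinct points can be moved, along the same word, to points where an extension of the
pre-action is undefined and which belong to distinct orbits of the edge group. -/
theorem Extendable.exists_separated {R : PreAction ϑ π} (hπ : RightAction.IsFree π)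
    (hinf : RightAction.HasInfinitelyManyOrbits π) (hA : A ≠ ⊤) (hB : B ≠ ⊤)
    (htriv : ∀ N : Bool → H → Prop, (∀ ε a, N ε a → a ∈ edgeGroup ϑ ε ∧
      ∀ b, Twist ϑ ε a b → ∀ h δ, Reduced ϑ ε h δ → N δ (h⁻¹ * b * h)) → ∀ ε a, N ε a → a = 1)
    (hR : R.Extendable) {p : ι → X} (hp : Function.Injective p) :
    ∃ (R' : PreAction ϑ π) (ε : Bool) (q : ι → X) (g : HNN ϑ), R ≤ R' ∧ R'.Extendable ∧
      (∀ i, R'.Moves (p i) g (q i)) ∧ (∀ i, ¬ R'.Dom ε (q i)) ∧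
      ∀ i j, i ≠ j → ∀ a ∈ edgeGroup ϑ ε, q j ≠ π a (q i) := by
  obtain ⟨R', ε, q, hm⟩ := exists_maxReach hR hp
  obtain ⟨g, hg⟩ := hm.moves
  refine ⟨R', ε, q, g, hm.le, hm.extendable, hg, hm.not_dom hπ hinf hA hB, ?_⟩
  intro i j hij a ha e
  -- The elements relating points `i` and `j` in all maximal configurations. Advancing twists and
  -- conjugates them; they stay in the edge groups, since otherwise the pair would become separated.
  let N : Bool → H → Prop := fun δ a => ∃ (S : PreAction ϑ π) (q : ι → X), MaxReach R p S δ q ∧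
    a ∈ edgeGroup ϑ δ ∧ q j = π a (q i)
  have := htriv N (by
    rintro δ a ⟨S, q, hm, ha, e⟩
    refine ⟨ha, fun b t h η hh => ?_⟩
    obtain ⟨S', q', l', hq', hadv, -⟩ := hm.advance hπ hinf δ Set.finite_empty
    obtain ⟨hreach, hsub, -⟩ := hadv h η hh
    obtain ⟨hm', heq⟩ := hm.of_subset hreach hsub
    have hb : q' j = π b (q' i) := by
      refine S'.unique (hq' j) ?_
      rw [e]
      exact S'.equivariant (hq' i) t
    have hb' : π h (q' j) = π (h⁻¹ * b * h) (π h (q' i)) := by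
      rw [hb, ← act_mul, ← act_mul]
      group
    refine ⟨S', _, hm', ?_, hb'⟩
    have hns : (i, j) ∉ S'.sepPairs η fun i => π h (q' i) := by
      rw [heq]
      rintro ⟨-, -, h | h⟩
      · exact hij h
      · exact h a ha e
    by_contra hnb
    refine hns ⟨hm'.not_dom hπ hinf hA hB i, hm'.not_dom hπ hinf hA hB j,
      .inr fun c hc ec => hnb ?_⟩
    rwa [act_cancel hπ (hb'.symm.trans ec)]) ε a ⟨R', q, hm, ha, e⟩
  rw [this, act_one] at e
  exact hij (hm.injective e.symm)

end PreAction

end Separate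

end HNN

namespace HNN

/-! ### Half-trees of the Bass–Serre tree -/

section Tree

variable {H : Type*} [Group H] {A B : Subgroup H} (ϑ : A ≃* B)

/-- The edge from `g H` to `g * letter ϑ ε H` given by the coset of `g`. -/
def treeEdge (ε : Bool) (g : HNN ϑ) : (HNN ϑ ⧸ baseA ϑ) ⊕ (HNN ϑ ⧸ baseB ϑ) :=
  match ε with
  | true => Sum.inl (g : HNN ϑ ⧸ baseA ϑ)
  | false => Sum.inr (g : HNN ϑ ⧸ baseB ϑ)

variable {ϑ}

theorem exists_treeEdge (e : (HNN ϑ ⧸ baseA ϑ) ⊕ (HNN ϑ ⧸ baseB ϑ)) :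
    ∃ ε g, e = treeEdge ϑ ε g := by
  rcases e with e | e <;> induction e using Quotient.inductionOn' with
  | h g => first | exact ⟨true, g, rfl⟩ | exact ⟨false, g, rfl⟩

theorem src_treeEdge (ε : Bool) (g : HNN ϑ) :
    (bassSerreTree ϑ).src (treeEdge ϑ ε g) = (g : HNN ϑ ⧸ base ϑ) := by
  cases ε <;> rfl

theorem bar_treeEdge (ε : Bool) (g : HNN ϑ) :
    (bassSerreTree ϑ).bar (treeEdge ϑ ε g) = treeEdge ϑ (!ε) (g * letter ϑ ε) := by
  cases ε <;> rfl

theorem rng_treeEdge (ε : Bool) (g : HNN ϑ) :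
    (bassSerreTree ϑ).rng (treeEdge ϑ ε g) = ((g * letter ϑ ε : HNN ϑ) : HNN ϑ ⧸ base ϑ) := by
  rw [← SerreGraph.src_bar, bar_treeEdge, src_treeEdge]

theorem treeEdge_mul_of {ε : Bool} {h : H} (hh : h ∈ edgeGroup ϑ ε) (g : HNN ϑ) :
    treeEdge ϑ ε (g * HNNExtension.of h) = treeEdge ϑ ε g := by
  cases ε
  · refine congrArg Sum.inr (QuotientGroup.eq.2 ?_)
    rw [mul_inv_rev, mul_assoc, inv_mul_cancel, mul_one, ← map_inv]
    exact Subgroup.mem_map_of_mem _ (inv_mem hh)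
  · refine congrArg Sum.inl (QuotientGroup.eq.2 ?_)
    rw [mul_inv_rev, mul_assoc, inv_mul_cancel, mul_one, ← map_inv]
    exact Subgroup.mem_map_of_mem _ (inv_mem hh)

theorem coe_mul_of (g : HNN ϑ) (h : H) :
    ((g * HNNExtension.of h : HNN ϑ) : HNN ϑ ⧸ base ϑ) = (g : HNN ϑ ⧸ base ϑ) := by
  refine QuotientGroup.eq.2 ?_
  rw [mul_inv_rev, mul_assoc, inv_mul_cancel, mul_one, ← map_inv]
  exact ⟨_, rfl⟩

theorem exists_mul_of_eq {g g' : HNN ϑ} (h : (g : HNN ϑ ⧸ base ϑ) = g') :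
    ∃ h, g' = g * HNNExtension.of h := by
  obtain ⟨h, e⟩ := QuotientGroup.eq.1 h
  exact ⟨h, by rw [e, mul_inv_cancel_left]⟩

/-- If the conjugates of an element along all reduced words stay in the edge groups, then the
element fixes the vertices of all reduced paths. -/
theorem smul_eq_of_isPath {N : Bool → H → Prop} (hN : ∀ ε a, N ε a → a ∈ edgeGroup ϑ ε ∧
      ∀ b, Twist ϑ ε a b → ∀ h δ, Reduced ϑ ε h δ → N δ (h⁻¹ * b * h)) (γ : HNN ϑ)
    (l : List ((HNN ϑ ⧸ baseA ϑ) ⊕ (HNN ϑ ⧸ baseB ϑ))) :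
    ∀ (ε : Bool) (g : HNN ϑ) (a : H) (v : HNN ϑ ⧸ base ϑ), N ε a →
      γ * g = g * HNNExtension.of a →
      (bassSerreTree ϑ).IsPath (bassSerreTree ϑ |>.src (treeEdge ϑ ε g)) (treeEdge ϑ ε g :: l) v →
      (bassSerreTree ϑ).IsReduced (treeEdge ϑ ε g :: l) → ∀ e ∈ treeEdge ϑ ε g :: l,
        γ • (bassSerreTree ϑ).src e = (bassSerreTree ϑ).src e ∧
        γ • (bassSerreTree ϑ).rng e = (bassSerreTree ϑ).rng e := by
  induction l with
  | nil =>
    intro ε g a v ha hγ _ _ e he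
    obtain rfl := List.mem_singleton.1 he
    obtain ⟨b, t⟩ := exists_twist (hN _ _ ha).1
    rw [src_treeEdge, rng_treeEdge]
    refine ⟨?_, ?_⟩
    · exact (congrArg _ hγ).trans (coe_mul_of _ _)
    · have hγ' : γ * (g * letter ϑ ε) = g * letter ϑ ε * HNNExtension.of b := by
        rw [← mul_assoc, hγ, mul_assoc, t.of_mul_letter, mul_assoc]
      exact (congrArg _ hγ').trans (coe_mul_of _ _)
  | cons f l ih =>
    intro ε g a v ha hγ hp hr e he
    obtain ⟨b, t⟩ := exists_twist (hN _ _ ha).1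
    have hγ' : γ * (g * letter ϑ ε) = g * letter ϑ ε * HNNExtension.of b := by
      rw [← mul_assoc, hγ, mul_assoc, t.of_mul_letter, mul_assoc]
    obtain rfl | he := List.mem_cons.1 he
    · rw [src_treeEdge, rng_treeEdge]
      exact ⟨(congrArg _ hγ).trans (coe_mul_of _ _), (congrArg _ hγ').trans (coe_mul_of _ _)⟩
    · obtain ⟨δ, g', rfl⟩ := exists_treeEdge f
      obtain ⟨-, hp⟩ := hp
      have hsrc := hp.1
      rw [src_treeEdge, rng_treeEdge] at hsrc
      obtain ⟨h, rfl⟩ := exists_mul_of_eq hsrc.symm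
      rw [SerreGraph.IsReduced, List.isChain_cons_cons] at hr
      have hh : Reduced ϑ ε h δ := by
        by_contra hh
        obtain ⟨rfl, hm⟩ := not_reduced hh
        exact hr.1 (by rw [bar_treeEdge, treeEdge_mul_of hm])
      refine ih δ _ _ v ((hN _ _ ha).2 b t h δ hh) ?_ ⟨rfl, hp.2⟩ hr.2 e he
      rw [← mul_assoc, hγ']
      simp [mul_assoc]

variable (ϑ) in
/-- The exponent sum of the stable letter. -/
def exponent : HNN ϑ →* Multiplicative ℤ :=
  HNNExtension.lift 1 (Multiplicative.ofAdd 1) (by simp)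

variable (ϑ) in
/-- The exponent sum of the stable letter, on vertices. -/
def height : HNN ϑ ⧸ base ϑ → ℤ :=
  Quotient.lift (fun g => (exponent ϑ g).toAdd) (by
    intro g g' h
    obtain ⟨h, rfl⟩ := exists_mul_of_eq (Quotient.sound h : (g : HNN ϑ ⧸ base ϑ) = g')
    simp [exponent])

theorem height_coe (g : HNN ϑ) : height ϑ g = (exponent ϑ g).toAdd := rfl

theorem exponent_letter (ε : Bool) :
    (exponent ϑ (letter ϑ ε)).toAdd = bif ε then 1 else -1 := by
  cases ε <;> simp [exponent, letter, stable]

/-- Each edge changes the height by one. This lower bound on distances shows that the powers of the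
stable letter form a geodesic ray without using that the graph is a tree. -/
theorem abs_height_sub_le {u v : HNN ϑ ⧸ base ϑ}
    {l : List ((HNN ϑ ⧸ baseA ϑ) ⊕ (HNN ϑ ⧸ baseB ϑ))} (h : (bassSerreTree ϑ).IsPath u l v) :
    |height ϑ v - height ϑ u| ≤ l.length := by
  induction l generalizing u with
  | nil =>
    obtain rfl : u = v := h
    simp
  | cons e l ih =>
    obtain ⟨rfl, h⟩ := h
    have h1 := ih h
    obtain ⟨ε, g, rfl⟩ := exists_treeEdge e
    rw [rng_treeEdge, height_coe, map_mul, toAdd_mul, exponent_letter] at h1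
    rw [src_treeEdge, height_coe, List.length_cons]
    push_cast
    rw [abs_le] at h1 ⊢
    cases ε <;> simp only [cond_true, cond_false] at h1 <;> constructor <;> linarith

variable (ϑ) in
/-- The initial segments of the ray of powers of the stable letter. -/
def powPath (ε : Bool) (i k : ℕ) : List ((HNN ϑ ⧸ baseA ϑ) ⊕ (HNN ϑ ⧸ baseB ϑ)) :=
  (List.range' i k).map fun n => treeEdge ϑ ε (letter ϑ ε ^ n)

theorem isPath_powPath (ε : Bool) (i k : ℕ) :
    (bassSerreTree ϑ).IsPath ((letter ϑ ε ^ i : HNN ϑ) : HNN ϑ ⧸ base ϑ) (powPath ϑ ε i k)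
      ((letter ϑ ε ^ (i + k) : HNN ϑ) : HNN ϑ ⧸ base ϑ) := by
  induction k generalizing i with
  | zero => rfl
  | succ k ih =>
    refine ⟨src_treeEdge _ _, ?_⟩
    have := ih (i + 1)
    rwa [rng_treeEdge, ← pow_succ, ← add_assoc, add_right_comm]

variable (ϑ) in
/-- The ray of powers of the stable letter. -/
def powRay (ε : Bool) : (bassSerreTree ϑ).GeodesicRay where
  edge n := treeEdge ϑ ε (letter ϑ ε ^ n)
  isPath k := by rw [rng_treeEdge, src_treeEdge, pow_succ]
  geodesic i k := by
    rw [src_treeEdge, src_treeEdge]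
    refine le_antisymm (Nat.sInf_le ⟨_, isPath_powPath ε i k, by simp [powPath]⟩)
      (le_csInf ⟨_, _, isPath_powPath ε i k, rfl⟩ ?_)
    rintro _ ⟨l, hl, rfl⟩
    have := abs_height_sub_le hl
    rw [height_coe, height_coe, pow_add, map_mul, toAdd_mul, add_sub_cancel_left, map_pow,
      toAdd_pow, exponent_letter] at this
    cases ε <;> simpa using this

theorem mem_halfGraphEdges_treeEdge (ε : Bool) (n : ℕ) :
    treeEdge ϑ ε (letter ϑ ε ^ n) ∈ (bassSerreTree ϑ).halfGraphEdges (treeEdge ϑ ε 1) := by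
  have hne : ∀ g g' : HNN ϑ, treeEdge ϑ ε g ≠ treeEdge ϑ (!ε) g' := fun g g' => by
    cases ε <;> simp [treeEdge]
  refine ⟨powPath ϑ ε 0 (n + 1), ((letter ϑ ε ^ (0 + (n + 1)) : HNN ϑ) : HNN ϑ ⧸ base ϑ),
    ?_, ?_, ?_, ?_, ?_⟩
  · have := isPath_powPath (ϑ := ϑ) ε 0 (n + 1)
    rwa [pow_zero, ← src_treeEdge ε] at this
  · refine (List.isChain_map _).2 (List.Pairwise.isChain (List.pairwise_of_forall fun _ _ => ?_))
    rw [bar_treeEdge]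
    exact hne _ _
  · simp [powPath, List.range'_succ]
  · rw [bar_treeEdge, powPath, List.mem_map]
    rintro ⟨k, -, e⟩
    exact hne _ _ e
  · simp [powPath, List.range'_concat]

/-- If the action on the boundary is topologically free, then the only element whose conjugates
along all reduced words stay in the edge groups is the trivial one. -/
theorem eq_one_of_forall_reduced
    (htf : IsTopologicallyFree (HNN ϑ) (bassSerreTree ϑ).Boundary) (N : Bool → H → Prop)
    (hN : ∀ ε a, N ε a → a ∈ edgeGroup ϑ ε ∧
      ∀ b, Twist ϑ ε a b → ∀ h δ, Reduced ϑ ε h δ → N δ (h⁻¹ * b * h))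
    (ε : Bool) (a : H) (ha : N ε a) : a = 1 := by
  have hfix : ∀ v ∈ (bassSerreTree ϑ).halfGraphVertices (treeEdge ϑ ε 1),
      (HNNExtension.of a : HNN ϑ) • v = v := by
    have key : ∀ f ∈ (bassSerreTree ϑ).halfGraphEdges (treeEdge ϑ ε 1),
        (HNNExtension.of a : HNN ϑ) • (bassSerreTree ϑ).src f = (bassSerreTree ϑ).src f ∧
        (HNNExtension.of a : HNN ϑ) • (bassSerreTree ϑ).rng f = (bassSerreTree ϑ).rng f := by
      rintro f ⟨l, v, hp, hr, hh, -, hf⟩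
      obtain ⟨l', rfl⟩ := List.head?_eq_some_iff.1 hh
      exact smul_eq_of_isPath hN _ l' ε 1 a v ha (by simp) hp hr f (List.mem_of_getLast? hf)
    rintro _ (⟨f, hf, rfl⟩ | ⟨f, hf, rfl⟩)
    exacts [(key f hf).1, (key f hf).2]
  -- An element fixing every vertex of the half-tree fixes all its ends; the ray of powers shows
  -- that there are some.
  have := htf (HNNExtension.of a) ((bassSerreTree ϑ).boundaryOpen (treeEdge ϑ ε 1))
    (TopologicalSpace.isOpen_generateFrom_of_mem ⟨_, rfl⟩)
    ⟨_, powRay ϑ ε, ?_, rfl⟩ ?_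
  · exact HNNExtension.of_injective _ (this.trans (map_one _).symm)
  · rintro _ ⟨k, rfl⟩
    exact .inl ⟨_, mem_halfGraphEdges_treeEdge ε k, rfl⟩
  · rintro _ ⟨ω, hω, rfl⟩
    refine Quotient.sound ?_
    change (symmDiff ((HNNExtension.of a : HNN ϑ) • ω).range ω.range).Finite
    rw [SerreGraph.range_smul, Set.image_congr fun v hv => hfix v (hω hv), Set.image_id',
      symmDiff_self]
    exact Set.finite_empty

end Tree

end HNN

namespace HNN

section Dense

variable {H : Type*} [Group H] {A B : Subgroup H} {ϑ : A ≃* B} {X : Type*} {π : H →* RightPerm X}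

namespace PreAction

/-! ### Highly transitive extensions -/

/-- Undefined points in distinct orbits of the edge group can be joined in pairs. -/
theorem Extendable.exists_join {R : PreAction ϑ π} (hπ : RightAction.IsFree π)
    (hinf : RightAction.HasInfinitelyManyOrbits π) (hR : R.Extendable) {ι : Type*} {ε : Bool}
    {h : H} (hh : h ∉ edgeGroup ϑ (!ε)) {q : ι ⊕ ι → X} (hq : ∀ i, ¬ R.Dom ε (q i))
    (hsep : ∀ i j, i ≠ j → ∀ a ∈ edgeGroup ϑ ε, q j ≠ π a (q i)) (s : Finset ι) :
    ∃ R' : PreAction ϑ π, R ≤ R' ∧ R'.Extendable ∧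
      (∀ i : ι ⊕ ι, i.elim id id ∉ s → ¬ R'.Dom ε (q i)) ∧
      ∀ i ∈ s, R'.Moves (q (.inl i)) (letter ϑ ε * HNNExtension.of h * letter ϑ (!ε))
        (q (.inr i)) := by
  classical
  induction s using Finset.induction_on with
  | empty => exact ⟨R, le_rfl, hR, fun i _ => hq i, by simp⟩
  | insert i s hi ih =>
    obtain ⟨R', l, hR', hd, hm⟩ := ih
    have hne : ε ≠ !ε := by cases ε <;> simp
    obtain ⟨z, hz, hzK⟩ := exists_fresh hinf R' (K := {q (.inl i), q (.inr i)}) (by simp)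
    have hz1 : ∀ k, π k z ≠ q (.inl i) := fun k e => hzK k (.inl e)
    have hz2 : ∀ k, π k z ≠ q (.inr i) := fun k e => hzK k (.inr e)
    have hu := hd (.inl i) hi
    have hv := hd (.inr i) hi
    have hd1 : ∀ x, ¬ R'.Dom ε x → (∀ a ∈ edgeGroup ϑ ε, x ≠ π a (q (.inl i))) →
        ¬ (R'.addEdge hπ ε _ z hu (hz.not_dom _)).Dom ε x := fun x hx hx' k => by
      obtain k | ⟨-, a, ha, e⟩ | ⟨e, -⟩ := dom_addEdge k
      exacts [hx k, hx' a ha e, hne e]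
    have hv' := hd1 _ hv (hsep _ _ (by simp))
    have hz' : ¬ (R'.addEdge hπ ε _ z hu (hz.not_dom _)).Dom (!ε) (π h z) := fun k => by
      obtain k | ⟨e, -⟩ | ⟨-, b, hb, e⟩ := dom_addEdge k
      -- Since `h` is outside the edge group, the orbit of `z` can receive a second edge at `π h z`.
      exacts [hz _ _ k, hne e.symm, hh (act_cancel hπ e ▸ hb)]
    have hd2 : ∀ x, ¬ R'.Dom ε x → (∀ a ∈ edgeGroup ϑ ε, x ≠ π a (q (.inl i))) →
        (∀ a ∈ edgeGroup ϑ ε, x ≠ π a (q (.inr i))) →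
        ¬ ((R'.addEdge hπ ε _ z hu (hz.not_dom _)).addEdge hπ ε _ (π h z) hv' hz').Dom ε x :=
      fun x hx hx' hx'' k => by
        obtain k | ⟨-, a, ha, e⟩ | ⟨e, -⟩ := dom_addEdge k
        exacts [hd1 x hx hx' k, hx'' a ha e, hne e]
    have hzh : ∀ x, (∀ k, π k z ≠ x) → ∀ a, π h z ≠ π a x := fun x hx a e => by
      refine hx (h * a⁻¹) ?_
      rw [act_mul, e, act_inv_act]
    have l1 : R' ≤ R'.addEdge hπ ε _ z hu (hz.not_dom _) := le_addEdge
    have l2 : R'.addEdge hπ ε _ z hu (hz.not_dom _) ≤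
      (R'.addEdge hπ ε _ z hu (hz.not_dom _)).addEdge hπ ε _ (π h z) hv' hz' := le_addEdge
    refine ⟨(R'.addEdge hπ ε _ z hu (hz.not_dom _)).addEdge hπ ε _ (π h z) hv' hz',
      l.trans (l1.trans l2), ?_, fun j hj => ?_, fun j hj => ?_⟩
    · exact (hR'.addEdge_fresh hz hz1).addEdge (conn_rel addEdge_rel) (hd2 _ (hz _ _)
        (fun a _ => hzh _ hz1 a) (fun a _ => hzh _ hz2 a))
    · rw [Finset.mem_insert, not_or] at hj
      refine hd2 _ (hd j hj.2) (hsep _ _ ?_) (hsep _ _ ?_)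
      · rintro rfl
        exact hj.1 rfl
      · rintro rfl
        exact hj.1 rfl
    · obtain rfl | hj := Finset.mem_insert.1 hj
      · refine ((moves_letter (l2 _ _ _ addEdge_rel)).trans (moves_of z h)).trans (moves_letter ?_)
        exact symm _ addEdge_rel
      · exact (hm j hj).mono (l1.trans l2)

/-- Sources and targets are separated together by one element `g`, joined in pairs by a common word
`w`, and brought back: the element is `g * w * g⁻¹`. -/
theorem Extendable.exists_moves_tuple {R : PreAction ϑ π} (hπ : RightAction.IsFree π)
    (hinf : RightAction.HasInfinitelyManyOrbits π) (hA : A ≠ ⊤) (hB : B ≠ ⊤)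
    (htf : IsTopologicallyFree (HNN ϑ) (bassSerreTree ϑ).Boundary)
    (hR : R.Extendable) {k : ℕ} {x y : Fin k → X} (hx : Function.Injective x)
    (hy : Function.Injective y) (hxy : ∀ i j, x i ≠ y j) :
    ∃ R' : PreAction ϑ π, R ≤ R' ∧ R'.Extendable ∧ ∃ g, ∀ i, R'.Moves (x i) g (y i) := by
  obtain ⟨R₁, ε, q, g, l₁, hR₁, hm, hd, hsep⟩ := hR.exists_separated hπ hinf hA hB
    (eq_one_of_forall_reduced htf) (hx.sumElim hy hxy)
  obtain ⟨h, hh⟩ := exists_notMem_edgeGroup (ϑ := ϑ) hA hB (!ε)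
  obtain ⟨R₂, l₂, hR₂, -, hm'⟩ := hR₁.exists_join hπ hinf hh hd hsep Finset.univ
  refine ⟨R₂, l₁.trans l₂, hR₂,
    g * (letter ϑ ε * HNNExtension.of h * letter ϑ (!ε)) * g⁻¹, fun i => ?_⟩
  exact (((hm (.inl i)).mono l₂).trans (hm' i (Finset.mem_univ i))).trans
    ((hm (.inr i)).mono l₂).symm

/-! ### Restrictions of transitive actions -/

/-- The restriction of an action to the orbits of finitely many points under the edge group. -/
def restrict (τ : actions ϑ π) (F : Finset X) : PreAction ϑ π where
  rel ε x y := match ε with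
    | true => (∃ u ∈ F, ∃ a ∈ edgeGroup ϑ true, x = π a u) ∧ (τ : RightPerm X) x = y
    | false => (∃ u ∈ F, ∃ a ∈ edgeGroup ϑ true, y = π a u) ∧ (τ : RightPerm X) y = x
  symm {ε x y} h := by cases ε <;> exact h
  unique {ε x y y'} h h' := by
    cases ε
    · exact (MulOpposite.unop (τ : RightPerm X)).injective (h.2.trans h'.2.symm)
    · exact h.2.symm.trans h'.2
  equivariant {ε x y a b} h t := by
    have key : ∀ x y a b, ((∃ u ∈ F, ∃ a ∈ edgeGroup ϑ true, x = π a u) ∧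
        (τ : RightPerm X) x = y) → Twist ϑ true a b →
        ((∃ u ∈ F, ∃ c ∈ edgeGroup ϑ true, π a x = π c u) ∧ (τ : RightPerm X) (π a x) = π b y) := by
      rintro x y a b ⟨⟨u, hu, c, hc, rfl⟩, rfl⟩ t
      refine ⟨⟨u, hu, c * a, mul_mem hc t.mem, (act_mul _ _ _).symm⟩, ?_⟩
      obtain ⟨ha, rfl⟩ := t
      exact congrArg (fun σ : RightPerm X => σ (π c u)) (τ.2 ⟨a, ha⟩)
    cases ε
    · exact key _ _ _ _ h t.symm
    · exact key _ _ _ _ h t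
  finite := by
    refine ⟨F ∪ (fun x => (τ : RightPerm X) x) '' F,
      F.finite_toSet.union (F.finite_toSet.image _), ?_⟩
    rintro (_ | _) x y h
    · obtain ⟨⟨u, hu, a, ha, rfl⟩, rfl⟩ := h
      obtain ⟨b, t⟩ := exists_twist ha
      refine ⟨_, .inr ⟨u, hu, rfl⟩, b, t.mem_right, ?_⟩
      obtain ⟨ha, rfl⟩ := t
      exact congrArg (fun σ : RightPerm X => σ u) (τ.2 ⟨a, ha⟩)
    · obtain ⟨⟨u, hu, a, ha, rfl⟩, rfl⟩ := h
      exact ⟨u, .inl hu, a, ha, rfl⟩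

theorem restrict_below (τ : actions ϑ π) (F : Finset X) :
    (restrict τ F).Below τ := fun _ _ h => h.2

theorem Below.eq_of_restrict {τ τ' : actions ϑ π} {F : Finset X} (h : (restrict τ F).Below τ')
    {x : X} (hx : x ∈ F) : (τ' : RightPerm X) x = (τ : RightPerm X) x :=
  h _ _ ⟨⟨x, hx, 1, one_mem _, (act_one _).symm⟩, rfl⟩

/-- A closed component is invariant under the whole group, hence equal to `X` by transitivity; but
there are fresh points, where nothing is defined. -/
theorem extendable_of_isTransitive (hinf : RightAction.HasInfinitelyManyOrbits π)
    {R : PreAction ϑ π} {τ : actions ϑ π} (hR : R.Below τ)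
    (hτ : RightAction.IsTransitive (toAction τ)) : R.Extendable := by
  intro x
  by_contra! hall
  have hl : ∀ ε c, R.Conn x c → R.Conn x (toAction τ (letter ϑ ε) c) := by
    intro ε c hc
    obtain ⟨y, hy⟩ := hall c ε hc
    rw [hR.letter hy]
    exact hc.trans (conn_rel hy)
  have hof : ∀ h c, R.Conn x c → R.Conn x (toAction τ (HNNExtension.of h) c) := by
    intro h c hc
    rw [toAction_of]
    exact hc.trans (conn_act c h)
  have key : ∀ g, (∀ c, R.Conn x c → R.Conn x (toAction τ g c)) ∧
      ∀ c, R.Conn x c → R.Conn x (toAction τ g⁻¹ c) := by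
    intro g
    induction g using HNNExtension.induction_on with
    | of h => exact ⟨hof h, by rw [← map_inv]; exact hof _⟩
    | t => exact ⟨hl true, hl false⟩
    | mul g g' h h' =>
      refine ⟨fun c hc => ?_, fun c hc => ?_⟩
      · rw [act_mul]
        exact h'.1 _ (h.1 _ hc)
      · rw [mul_inv_rev, act_mul]
        exact h.2 _ (h'.2 _ hc)
    | inv g h => exact ⟨h.2, by rw [inv_inv]; exact h.1⟩
  obtain ⟨z, hz, -⟩ := exists_fresh hinf R Set.finite_empty
  obtain ⟨g, rfl⟩ := hτ x z
  exact hz.not_dom true (hall _ true ((key g).1 x (.refl x)))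

end PreAction

end Dense

end HNN

/-! ### Countably many conditions, and the topology on the space of actions -/

namespace HNN

section Spaces

variable {H : Type*} [Group H] {A B : Subgroup H} {ϑ : A ≃* B} {X : Type*} {π : H →* RightPerm X}

/-- Go through a third tuple disjoint from both. -/
theorem isHighlyTransitive_of_disjoint {G : Type*} [Group G] [Infinite X] {α : G →* RightPerm X}
    (h : ∀ (k : ℕ) (x y : Fin k → X), Function.Injective x → Function.Injective y →
      (∀ i j, x i ≠ y j) → ∃ g : G, ∀ i, α g (x i) = y i) : RightAction.IsHighlyTransitive α := by
  intro k x y hx hy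
  have hinf : ((Set.range x ∪ Set.range y)ᶜ).Infinite :=
    ((Set.finite_range x).union (Set.finite_range y)).infinite_compl
  let z : Fin k → X := fun i => hinf.natEmbedding _ i
  have hz : Function.Injective z := fun i j e =>
    Fin.ext ((hinf.natEmbedding _).injective (Subtype.ext e))
  have hz' : ∀ i, z i ∉ Set.range x ∪ Set.range y := fun i => (hinf.natEmbedding _ i).2
  obtain ⟨g, hg⟩ := h k x z hx hz fun i j e => hz' j (.inl ⟨i, e⟩)
  obtain ⟨g', hg'⟩ := h k z y hz hy fun i j e => hz' i (.inr ⟨j, e.symm⟩)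
  exact ⟨g * g', fun i => by rw [act_mul, hg, hg']⟩

theorem isHighlyFaithful_iff {G : Type*} [Group G] {α : G →* RightPerm X} :
    RightAction.IsHighlyFaithful α ↔ ∀ F : Finset G, (1 : G) ∉ F → ∀ K : Finset X,
      ∃ x ∉ K, ∀ g ∈ F, α g x ≠ x := by
  refine forall₂_congr fun F _ => ⟨fun h K => ?_, fun h hfin => ?_⟩
  · obtain ⟨x, hx, hK⟩ := h.exists_notMem_finset K
    exact ⟨x, hK, by simpa [RightPerm.support] using hx⟩
  · obtain ⟨x, hx, h⟩ := h hfin.toFinset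
    exact hx (hfin.mem_toFinset.2 (Set.mem_iInter₂.2 h))

theorem isTransitive_of_isHighlyTransitive {G : Type*} [Group G] {α : G →* RightPerm X}
    (h : RightAction.IsHighlyTransitive α) : RightAction.IsTransitive α := by
  intro x y
  obtain ⟨g, hg⟩ := h 1 (fun _ => x) (fun _ => y) (Function.injective_of_subsingleton _)
    (Function.injective_of_subsingleton _)
  exact ⟨g, hg 0⟩

instance [Countable H] : Countable (HNN ϑ) := by
  let f : List (H ⊕ Bool) → HNN ϑ := fun l =>
    (l.map (Sum.elim (fun h => HNNExtension.of h) (letter ϑ))).prod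
  have key : ∀ g : HNN ϑ, g ∈ Set.range f ∧ g⁻¹ ∈ Set.range f := by
    have hmul : ∀ g g', g ∈ Set.range f → g' ∈ Set.range f → g * g' ∈ Set.range f := by
      rintro _ _ ⟨l, rfl⟩ ⟨l', rfl⟩
      exact ⟨l ++ l', by simp [f]⟩
    intro g
    induction g using HNNExtension.induction_on with
    | of h => exact ⟨⟨[.inl h], by simp [f]⟩, ⟨[.inl h⁻¹], by simp [f]⟩⟩
    | t => exact ⟨⟨[.inr true], by simp [f, letter]⟩, ⟨[.inr false], by simp [f, letter]⟩⟩
    | mul g g' h h' => exact ⟨hmul _ _ h.1 h'.1, by rw [mul_inv_rev]; exact hmul _ _ h'.2 h.2⟩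
    | inv g h => exact ⟨h.2, by rw [inv_inv]; exact h.1⟩
  exact Function.Surjective.countable (f := f) fun g => (key g).1

/-- Pre-actions extend to highly transitive and highly faithful actions. -/
theorem PreAction.Extendable.exists_below [Countable H] [Countable X] [Infinite X]
    {R : PreAction ϑ π} (hπ : RightAction.IsFree π)
    (hinf : RightAction.HasInfinitelyManyOrbits π) (hA : A ≠ ⊤) (hB : B ≠ ⊤)
    (htf : IsTopologicallyFree (HNN ϑ) (bassSerreTree ϑ).Boundary) (hR : R.Extendable) :
    ∃ τ : actions ϑ π, R.Below τ ∧ τ ∈ highlyTransitiveActions ϑ π ∩ highlyFaithfulActions ϑ π := by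
  let ι₁ := Σ k : ℕ, {p : (Fin k → X) × (Fin k → X) //
    Function.Injective p.1 ∧ Function.Injective p.2 ∧ ∀ i j, p.1 i ≠ p.2 j}
  let ι₂ := {F : Finset (HNN ϑ) // 1 ∉ F} × Finset X
  let D : ι₁ ⊕ ι₂ → Set (PreAction ϑ π) := Sum.elim
    (fun p => {S | ∃ g, ∀ i, S.Moves (p.2.1.1 i) g (p.2.1.2 i)})
    (fun p => {S | ∃ z ∉ (p.2 : Set X), ∀ g ∈ p.1.1, ∃ y ≠ z, S.Moves z g y})
  obtain ⟨τ, hτ, h⟩ := exists_generic hπ hinf hR D (by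
    rintro (⟨k, ⟨x, y⟩, hx, hy, hxy⟩ | ⟨⟨F, hF⟩, K⟩) S hS
    · exact hS.exists_moves_tuple hπ hinf hA hB htf hx hy hxy
    · exact exists_forall_moves_ne hπ hinf hS F hF K.finite_toSet)
  refine ⟨τ, hτ, isHighlyTransitive_of_disjoint fun k x y hx hy hxy => ?_,
    isHighlyFaithful_iff.2 fun F hF K => ?_⟩
  · obtain ⟨S, ⟨g, hg⟩, hS⟩ := h (.inl ⟨k, ⟨x, y⟩, hx, hy, hxy⟩)
    exact ⟨g, fun i => hS.moves (hg i)⟩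
  · obtain ⟨S, ⟨z, hz, hg⟩, hS⟩ := h (.inr ⟨⟨F, hF⟩, K⟩)
    refine ⟨z, hz, fun g hgF => ?_⟩
    obtain ⟨y, hy, m⟩ := hg g hgF
    rw [hS.moves m]
    exact hy

/-! ### Topology -/

theorem isOpen_setOf_apply_eq (x y : X) : IsOpen {σ : RightPerm X | σ x = y} := by
  let _ : TopologicalSpace X := ⊥
  have : DiscreteTopology X := ⟨rfl⟩
  exact ⟨_, (isOpen_discrete {y}).preimage (continuous_apply x), rfl⟩

theorem exists_finset_of_isOpen {U : Set (RightPerm X)} (hU : IsOpen U) {σ : RightPerm X}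
    (hσ : σ ∈ U) : ∃ F : Finset X, ∀ σ' : RightPerm X, (∀ x ∈ F, σ' x = σ x) → σ' ∈ U := by
  let _ : TopologicalSpace X := ⊥
  have : DiscreteTopology X := ⟨rfl⟩
  obtain ⟨V, hV, rfl⟩ := hU
  obtain ⟨F, u, hu, hF⟩ := isOpen_pi_iff.1 hV _ hσ
  refine ⟨F, fun σ' h => hF fun x hx => ?_⟩
  change σ' x ∈ u x
  exact (h x hx).symm ▸ (hu x hx).2

theorem isOpen_setOf_toAction_apply_eq (g : HNN ϑ) :
    ∀ x y, IsOpen {τ : actions ϑ π | toAction τ g x = y} := by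
  induction g using HNNExtension.induction_on with
  | of h =>
    intro x y
    simp only [toAction_of]
    exact isOpen_const
  | t =>
    intro x y
    have : {τ : actions ϑ π | toAction τ (stable ϑ) x = y} =
        Subtype.val ⁻¹' {σ : RightPerm X | σ x = y} := by
      ext τ
      rw [Set.mem_ofPred_eq, toAction_stable]
      rfl
    exact this ▸ (isOpen_setOf_apply_eq x y).preimage continuous_subtype_val
  | mul g g' h h' =>
    intro x y
    have : {τ : actions ϑ π | toAction τ (g * g') x = y} =
        ⋃ z, {τ | toAction τ g x = z} ∩ {τ | toAction τ g' z = y} := by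
      ext τ
      simp only [Set.mem_ofPred_eq, Set.mem_iUnion, Set.mem_inter_iff, act_mul]
      exact ⟨fun e => ⟨_, rfl, e⟩, fun ⟨_, e, e'⟩ => by rw [e, e']⟩
    exact this ▸ isOpen_iUnion fun z => (h x z).inter (h' z y)
  | inv g h =>
    intro x y
    have : {τ : actions ϑ π | toAction τ g⁻¹ x = y} = {τ | toAction τ g y = x} := by
      ext τ
      constructor
      · rintro rfl
        exact act_act_inv _ _
      · rintro rfl
        exact act_inv_act _ _
    exact this ▸ h y x

theorem isGδ_transitiveActions [Countable X] : IsGδ (transitiveActions ϑ π) := by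
  have : transitiveActions ϑ π = ⋂ x, ⋂ y, ⋃ g, {τ | toAction τ g x = y} := by
    ext τ
    simp only [Set.mem_iInter, Set.mem_iUnion]
    rfl
  rw [this]
  exact .iInter fun x => .iInter fun y =>
    (isOpen_iUnion fun g => isOpen_setOf_toAction_apply_eq g x y).isGδ

theorem isGδ_highlyTransitiveActions [Countable X] : IsGδ (highlyTransitiveActions ϑ π) := by
  have : highlyTransitiveActions ϑ π = ⋂ k : ℕ, ⋂ x : Fin k → X, ⋂ y : Fin k → X,
      ⋂ _ : Function.Injective x, ⋂ _ : Function.Injective y,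
        ⋃ g, ⋂ i, {τ | toAction τ g (x i) = y i} := by
    ext τ
    simp only [Set.mem_iInter, Set.mem_iUnion]
    rfl
  rw [this]
  exact .iInter fun k => .iInter fun x => .iInter fun y => .iInter fun _ => .iInter fun _ =>
    (isOpen_iUnion fun g => isOpen_iInter_of_finite fun i =>
      isOpen_setOf_toAction_apply_eq g (x i) (y i)).isGδ

theorem isGδ_highlyFaithfulActions [Countable H] [Countable X] :
    IsGδ (highlyFaithfulActions ϑ π) := by
  have : highlyFaithfulActions ϑ π = ⋂ F : Finset (HNN ϑ), ⋂ _ : (1 : HNN ϑ) ∉ F,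
      ⋂ K : Finset X, ⋃ x, ⋃ _ : x ∉ K, ⋂ g ∈ F, ⋃ y, ⋃ _ : y ≠ x, {τ | toAction τ g x = y} := by
    ext τ
    refine isHighlyFaithful_iff.trans ?_
    simp
  rw [this]
  exact .iInter fun F => .iInter fun _ => .iInter fun K =>
    (isOpen_iUnion fun x => isOpen_iUnion fun _ => isOpen_biInter_finset fun g _ =>
      isOpen_iUnion fun y => isOpen_iUnion fun _ => isOpen_setOf_toAction_apply_eq g x y).isGδ

/-- The diagonal map embeds the intersection as a closed subset of the countable product of the open
sets. -/
theorem polishSpace_of_isGδ {Y : Type*} [TopologicalSpace Y] [PolishSpace Y] {s : Set Y}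
    (hs : IsGδ s) : PolishSpace s := by
  obtain ⟨U, hU, rfl⟩ := isGδ_iff_eq_iInter_nat.1 hs
  have : ∀ n, PolishSpace (U n) := fun n => (hU n).polishSpace
  let f : (⋂ n, U n : Set Y) → ∀ n, U n := fun x n => ⟨x, Set.mem_iInter.1 x.2 n⟩
  have hf : Continuous f := continuous_pi fun n => continuous_subtype_val.subtype_mk _
  have hg : Continuous fun h : ∀ n, U n => (h 0 : Y) :=
    continuous_subtype_val.comp (continuous_apply 0)
  have hr : Set.range f = {h | ∀ n, (h n : Y) = h 0} := by
    ext h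
    constructor
    · rintro ⟨x, rfl⟩ n
      rfl
    · intro hh
      refine ⟨⟨h 0, Set.mem_iInter.2 fun n => hh n ▸ (h n).2⟩, ?_⟩
      funext n
      exact Subtype.ext (hh n).symm
  have hemb : Topology.IsClosedEmbedding f :=
    { toIsInducing := .of_comp hf hg Topology.IsInducing.subtypeVal
      injective := fun x y e => Subtype.ext (congrArg (fun h : ∀ n, U n => (h 0 : Y)) e)
      isClosed_range := by
        rw [hr, Set.ofPred_forall]
        exact isClosed_iInter fun n =>
          isClosed_eq (continuous_subtype_val.comp (continuous_apply n)) hg }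
  exact hemb.polishSpace

/-- Recording a permutation with its inverse gives a closed embedding into a Polish space; the
permutation alone would not have closed image. -/
theorem polishSpace_actions [Countable X] : PolishSpace (actions ϑ π) := by
  let _ : TopologicalSpace X := ⊥
  have : DiscreteTopology X := ⟨rfl⟩
  let f : actions ϑ π → (X → X) × (X → X) := fun τ =>
    (fun x => toAction τ (letter ϑ true) x, fun x => toAction τ (letter ϑ false) x)
  have hc : ∀ g : HNN ϑ, Continuous fun (τ : actions ϑ π) (x : X) => toAction τ g x := fun g =>
    continuous_pi fun x => continuous_discrete_rng.2 fun y =>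
      isOpen_setOf_toAction_apply_eq g x y
  have hf : Continuous f := (hc _).prodMk (hc _)
  have hval : ∀ τ : actions ϑ π, (f τ).1 = fun x => (τ : RightPerm X) x := fun τ => by
    change (fun x => toAction τ (stable ϑ) x) = _
    rw [toAction_stable]
  have hr : Set.range f = {p | (∀ x, p.2 (p.1 x) = x) ∧ (∀ x, p.1 (p.2 x) = x) ∧
      ∀ (a : A) x, p.1 (π a x) = π (ϑ a) (p.1 x)} := by
    ext p
    constructor
    · rintro ⟨τ, rfl⟩
      refine ⟨fun x => act_inv_act (π := toAction τ) (stable ϑ) x,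
        fun x => act_act_inv (π := toAction τ) (stable ϑ) x, fun a x => ?_⟩
      rw [hval]
      exact congrArg (fun σ : RightPerm X => σ x) (τ.2 a)
    · rintro ⟨h1, h2, h3⟩
      let σ : Equiv.Perm X := ⟨p.1, p.2, h1, h2⟩
      have hσ : (MulOpposite.op σ : RightPerm X) ∈ actions ϑ π := fun a =>
        MulOpposite.unop_injective (Equiv.ext fun x => h3 a x)
      have e : (f ⟨_, hσ⟩).1 = p.1 := hval _
      refine ⟨⟨_, hσ⟩, Prod.ext e (funext fun x => ?_)⟩
      have h4 : (f ⟨_, hσ⟩).1 ((f ⟨_, hσ⟩).2 x) = x :=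
        act_act_inv (π := toAction (⟨_, hσ⟩ : actions ϑ π)) (stable ϑ) x
      rw [e] at h4
      exact σ.injective (h4.trans (h2 x).symm)
  have hind : Topology.IsInducing fun τ : actions ϑ π => (f τ).1 := by
    have : (fun τ : actions ϑ π => (f τ).1) =
        (fun (σ : RightPerm X) (x : X) => σ x) ∘ Subtype.val := funext hval
    rw [this]
    exact Topology.IsInducing.comp ⟨rfl⟩ .subtypeVal
  have hemb : Topology.IsClosedEmbedding f :=
    { toIsInducing := .of_comp hf continuous_fst hind
      injective := fun τ τ' e => by
        refine Subtype.ext (MulOpposite.unop_injective (Equiv.ext fun x => ?_))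
        have := congrArg Prod.fst e
        rw [hval, hval] at this
        exact congrFun this x
      isClosed_range := by
        have c1 : ∀ x : X, Continuous fun p : (X → X) × (X → X) => p.1 x := fun x =>
          (continuous_apply x).comp continuous_fst
        have c2 : ∀ x : X, Continuous fun p : (X → X) × (X → X) => p.2 x := fun x =>
          (continuous_apply x).comp continuous_snd
        have cc : ∀ u v : (X → X) × (X → X) → (X → X), Continuous u → Continuous v →
            ∀ x, Continuous fun p => u p (v p x) := fun u v hu hv x => by
          refine continuous_discrete_rng.2 fun y => ?_
          have : (fun p => u p (v p x)) ⁻¹' {y} =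
              ⋃ z, (fun p => v p x) ⁻¹' {z} ∩ (fun p => u p z) ⁻¹' {y} := by
            ext p
            simp
          rw [this]
          exact isOpen_iUnion fun z =>
            ((isOpen_discrete _).preimage ((continuous_apply x).comp hv)).inter
              ((isOpen_discrete _).preimage ((continuous_apply z).comp hu))
        rw [hr]
        simp only [Set.ofPred_and, Set.ofPred_forall]
        refine (isClosed_iInter fun x => ?_).inter
          ((isClosed_iInter fun x => ?_).inter
            (isClosed_iInter fun a => isClosed_iInter fun x => ?_))
        · exact isClosed_eq (cc _ _ continuous_snd continuous_fst x) continuous_const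
        · exact isClosed_eq (cc _ _ continuous_fst continuous_snd x) continuous_const
        · exact isClosed_eq (c1 _) (continuous_of_discreteTopology.comp (c1 x)) }
  have : PolishSpace X := inferInstance
  exact hemb.polishSpace

end Spaces

end HNN

/-! ### A free action of the base group, and the main theorem -/

theorem exists_free_action_nat (H : Type*) [Group H] [Countable H] :
    ∃ π : H →* RightPerm ℕ, RightAction.IsFree π ∧ RightAction.HasInfinitelyManyOrbits π := by
  obtain ⟨e⟩ := nonempty_equiv_of_countable (α := H × ℕ) (β := ℕ)
  let π : H →* RightPerm ℕ :=
    { toFun := fun h => MulOpposite.op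
        (e.symm.trans (((Equiv.mulRight h).prodCongr (Equiv.refl ℕ)).trans e))
      map_one' := MulOpposite.unop_injective (Equiv.ext fun x => by
        change e ((e.symm x).1 * 1, (e.symm x).2) = x
        simp)
      map_mul' := fun g h => MulOpposite.unop_injective (Equiv.ext fun x => by
        change e ((e.symm x).1 * (g * h), (e.symm x).2) =
          e ((e.symm (e ((e.symm x).1 * g, (e.symm x).2))).1 * h,
            (e.symm (e ((e.symm x).1 * g, (e.symm x).2))).2)
        simp [mul_assoc]) }
  have hπ : ∀ h x, π h x = e ((e.symm x).1 * h, (e.symm x).2) := fun _ _ => rfl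
  refine ⟨π, fun h x hx => ?_, ?_⟩
  · rw [hπ, ← e.eq_symm_apply] at hx
    simpa using congrArg Prod.fst hx
  · refine Set.infinite_of_injective_forall_mem (f := fun n : ℕ => RightAction.orbit π (e (1, n)))
      (fun m n h => ?_) fun n => ⟨_, rfl⟩
    have : e (1, m) ∈ RightAction.orbit π (e (1, n)) := by
      exact (show RightAction.orbit π (e (1, m)) = RightAction.orbit π (e (1, n)) from h).subset
        ⟨1, HNN.act_one _⟩
    obtain ⟨g, hg⟩ := this
    have hg : π g (e (1, n)) = e (1, m) := hg
    rw [hπ, e.apply_eq_iff_eq] at hg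
    simpa using (congrArg Prod.snd hg).symm

theorem theoremC {H : Type*} [Group H] [Countable H] {A B : Subgroup H} (ϑ : A ≃* B)
    (hA : A ≠ ⊤) (hB : B ≠ ⊤)
    (htf : IsTopologicallyFree (HNN ϑ) (HNN.bassSerreTree ϑ).Boundary) :
    (∃ α : HNN ϑ →* RightPerm ℕ,
      RightAction.IsHighlyTransitive α ∧ RightAction.IsHighlyFaithful α) ∧
    IsHighlyTransitiveGroup (HNN ϑ) ∧
    ∀ (X : Type*) [Countable X] [Infinite X] (π : H →* RightPerm X),
      RightAction.IsFree π → RightAction.HasInfinitelyManyOrbits π →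
        PolishSpace (HNN.transitiveActions ϑ π) ∧
        (HNN.transitiveActions ϑ π).Nonempty ∧
        HNN.highlyTransitiveActions ϑ π ∩ HNN.highlyFaithfulActions ϑ π ⊆
          HNN.transitiveActions ϑ π ∧
        IsGδ {τ : HNN.transitiveActions ϑ π |
          (τ : HNN.actions ϑ π) ∈
            HNN.highlyTransitiveActions ϑ π ∩ HNN.highlyFaithfulActions ϑ π} ∧
        Dense {τ : HNN.transitiveActions ϑ π |
          (τ : HNN.actions ϑ π) ∈
            HNN.highlyTransitiveActions ϑ π ∩ HNN.highlyFaithfulActions ϑ π} := by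
  have hex : ∃ α : HNN ϑ →* RightPerm ℕ,
      RightAction.IsHighlyTransitive α ∧ RightAction.IsHighlyFaithful α := by
    obtain ⟨π, hπ, hinf⟩ := exists_free_action_nat H
    obtain ⟨τ, -, hτ⟩ := (HNN.PreAction.extendable_empty ϑ π).exists_below hπ hinf hA hB htf
    exact ⟨_, hτ⟩
  refine ⟨hex, ?_, ?_⟩
  · obtain ⟨α, h1, h2⟩ := hex
    refine ⟨α, fun g hg => ?_, h1⟩
    simpa using (h2 {g} (by simpa using hg.symm)).nonempty
  · intro X _ _ π hπ hinf
    have hsub : HNN.highlyTransitiveActions ϑ π ∩ HNN.highlyFaithfulActions ϑ π ⊆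
        HNN.transitiveActions ϑ π := fun τ hτ => HNN.isTransitive_of_isHighlyTransitive hτ.1
    have := HNN.polishSpace_actions (ϑ := ϑ) (π := π)
    refine ⟨HNN.polishSpace_of_isGδ HNN.isGδ_transitiveActions, ?_, hsub, ?_, ?_⟩
    · obtain ⟨τ, -, hτ⟩ := (HNN.PreAction.extendable_empty ϑ π).exists_below hπ hinf hA hB htf
      exact ⟨τ, hsub hτ⟩
    · exact (HNN.isGδ_highlyTransitiveActions.inter HNN.isGδ_highlyFaithfulActions).preimage
        continuous_subtype_val
    · refine dense_iff_inter_open.2 ?_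
      rintro _ ⟨_, ⟨U, hU, rfl⟩, rfl⟩ ⟨τ, hτ⟩
      obtain ⟨F, hF⟩ := HNN.exists_finset_of_isOpen hU hτ
      -- A basic neighbourhood prescribes `τ` on the finite set `F`; extending the restriction of
      -- `τ` to `F` generically yields a point of the neighbourhood.
      obtain ⟨τ', hτ', h⟩ := (HNN.PreAction.extendable_of_isTransitive hinf
        (HNN.PreAction.restrict_below τ.1 F) τ.2).exists_below hπ hinf hA hB htf
      exact ⟨⟨τ', hsub h⟩, hF _ fun x hx => hτ'.eq_of_restrict hx, h⟩
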